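/- Let $d,n,L\ge 1$ be integers, $N:=n+1$, and let $\Omega\subset[0,1)^d$ be a finite nonempty set of nodes. Let $A$ be the multivariate Vandermonde matrix $A=\big(e^{2\pi i\,\alpha\cdot t}\big)_{t\in\Omega,\ \alpha\in\{0,\dots,n\}^d}\in\mathbb C^{|\Omega|\times N^d}$ and $\sigma_{\min}(A):=\min_{\|v\|_2=1}\|A^*v\|_2$. For $s,t\in[0,1)^d$ let $|s-t|_{\mathbb T^d}:=\min_{r\in\mathbb Z^d}\|s-t+r\|_\infty$ be the wrap-around distance. Assume that $\Omega$ is a clustered node configuration: $\Omega=\Lambda_1\cup\dots\cup\Lambda_L$ with nonempty sets $\Lambda_l$, each contained in a closed axis-parallel cube of side length $1/N$ of the torus $\mathbb R^d/\mathbb Z^d$, such that $$\rho:=N\min_{1\le l<l'\le L}\ \min_{t'\in\Lambda_l,\,t''\in\Lambda_{l'}}|t'-t''|_{\mathbb T^d}>1$$ (with $\rho:=\infty$ if $L=1$). Let $\lambda:=\max_l|\Lambda_l|$ and let $$\mathcal C:=\max_{t\in\Omega}\ \prod_{t'\in\Omega:\ 0<|t-t'|_{\mathbb T^d}\le 1/N}\frac{1}{N|t-t'|_{\mathbb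 T^d}}$$ be the cluster complexity. (i) Let $\beta:=d+1$ if $d$ is odd and $\beta:=d+2$ if $d$ is even, and assume $N>2\beta^2\lambda$. If $\rho\ge 6d\lambda\,(\lambda^\lambda\mathcal C)^{1/(d+1)}$, then $$\sigma_{\min}(A)\ \ge\ \left(3\,d^{d/4}\lambda^{\lambda+d/2-1/2}\right)^{-1}\frac{N^{d/2}}{\mathcal C}.$$ (ii) Let $\beta:=2\left\lceil\tfrac12\log\!\left(2^d(2^d-1)\lambda^\lambda\zeta(2)\,\mathcal C\right)\right\rceil$, and assume $N>2\beta^2\lambda$. If $\rho\ge 3.3\,\lambda\,(2.5+1.4d+\lambda\log\lambda+\log\mathcal C)$, then $$\sigma_{\min}(A)\ \ge\ \left(1.5\,(2.5+1.4d+\lambda\log\lambda+\log\mathcal C)^{d/4}\lambda^{\lambda+d/2-1/2}\right)^{-1}\frac{N^{d/2}}{\mathcal C}.$$ -/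

import Mathlib

open scoped ENNReal

noncomputable section

/-- The nodes are points `t ∈ [0,1)^d`; the space `Fin d → ℝ` carries the max-norm.
`wrapDist s t = min_{r ∈ ℤ^d} ‖s - t + r‖_∞` is the wrap-around distance. -/
def wrapDist {d : ℕ} (s t : Fin d → ℝ) : ℝ :=
  ⨅ r : Fin d → ℤ, ‖s - t + fun i => (r i : ℝ)‖

/-- The Vandermonde matrix `A(Ω, n) = (z_t ^ α)`, with rows indexed by the nodes `t ∈ Ω`, columns
indexed by the multi-indices `α ∈ {0, …, n}^d`, and `z_t = (exp(2πi t_1), …, exp(2πi t_d))`. -/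
def vandermondeMatrix {d : ℕ} (Ω : Finset (Fin d → ℝ)) (n : ℕ) :
    Matrix Ω (Fin d → Fin (n + 1)) ℂ :=
  Matrix.of fun t α =>
    ∏ i : Fin d, Complex.exp (2 * Real.pi * Complex.I * ((t : Fin d → ℝ) i : ℂ)) ^ (α i : ℕ)

/-- `sigmaMin A = min_{‖v‖₂ = 1} ‖A^* v‖₂` (Euclidean norms). -/
def sigmaMin {m k : Type*} [Fintype m] [Fintype k] (A : Matrix m k ℂ) : ℝ :=
  ⨅ v : Metric.sphere (0 : EuclideanSpace ℂ m) 1,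
    ‖(WithLp.toLp 2 (A.conjTranspose.mulVec (v : EuclideanSpace ℂ m).ofLp) : EuclideanSpace ℂ k)‖

/-- A set of nodes is a cluster if it lies in a (closed, axis-parallel) cube of side length `1/N`
of the torus `ℝ^d / ℤ^d`; `c` is the lower corner of the cube. -/
def IsCluster {d : ℕ} (N : ℕ) (Λ : Finset (Fin d → ℝ)) : Prop :=
  ∃ c : Fin d → ℝ, ∀ t ∈ Λ, ∃ r : Fin d → ℤ,
    ∀ i, c i ≤ t i + r i ∧ t i + r i ≤ c i + 1 / (N : ℝ)

/-- `dist(Λ', Λ'')`, the minimal wrap-around distance between nodes of the two clusters. -/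
def clusterDist {d : ℕ} (Λ' Λ'' : Finset (Fin d → ℝ)) : ℝ≥0∞ :=
  ⨅ t' ∈ Λ', ⨅ t'' ∈ Λ'', ENNReal.ofReal (wrapDist t' t'')

/-- The normalized minimal cluster separation `ρ = N min_{l < l'} dist(Λ_l, Λ_{l'})`. It is `∞`
exactly when there is no pair of (nonempty) clusters, i.e. for a single cluster. -/
def clusterSep {d L : ℕ} (N : ℕ) (Λ : Fin L → Finset (Fin d → ℝ)) : ℝ≥0∞ :=
  (N : ℝ≥0∞) * ⨅ (l : Fin L) (l' : Fin L) (_ : l < l'), clusterDist (Λ l) (Λ l')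

/-- `Ω = Λ_1 ∪ … ∪ Λ_L` is a clustered node configuration in `[0,1)^d`. -/
structure IsClusteredConfiguration {d L : ℕ} (N : ℕ) (Ω : Finset (Fin d → ℝ))
    (Λ : Fin L → Finset (Fin d → ℝ)) : Prop where
  mem_Ico : ∀ t ∈ Ω, ∀ i, t i ∈ Set.Ico (0 : ℝ) 1
  mem_iff : ∀ t, t ∈ Ω ↔ ∃ l, t ∈ Λ l
  nonempty : ∀ l, (Λ l).Nonempty
  isCluster : ∀ l, IsCluster N (Λ l)
  one_lt_sep : 1 < clusterSep N Λ

/-- The cardinality `λ` of the biggest cluster. -/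
def maxClusterCard {d L : ℕ} (Λ : Fin L → Finset (Fin d → ℝ)) : ℕ :=
  Finset.univ.sup fun l => (Λ l).card

open Classical in
/-- The cluster complexity `𝒞(Ω, N)`. -/
def clusterComplexity {d : ℕ} (Ω : Finset (Fin d → ℝ)) (N : ℕ) : ℝ :=
  ⨆ t : Ω, ∏ t' ∈ Ω with 0 < wrapDist (t : Fin d → ℝ) t' ∧
    wrapDist (t : Fin d → ℝ) t' ≤ 1 / (N : ℝ), 1 / ((N : ℝ) * wrapDist (t : Fin d → ℝ) t')

end

/-! The bound is proved by duality. Suppose each node `t` carries a vector `c t` such that `A (c t)`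
is close to the unit vector at `t` and the Gram matrix of the `c t` is small. For a unit vector `v`
put `f = ∑ v_t c_t`. Then `⟨A^* v, f⟩` is within `ε` of `1`, while `‖f‖ ≤ √G`, so Cauchy-Schwarz
gives `‖A^* v‖ ≥ (1 - ε) / √G` (`le_sigmaMin_of_approx_dual`).

The vector `c t` is the coefficient tensor of a product of univariate polynomials of degree at most
`n`, so `A (c t)` lists its values at the nodes. The product is `1` at `t`. Lagrange-type factors
make it vanish at the other nodes of the cluster of `t`, at a cost of at most `lam ^ (lam - 1) * C`.
The `β`-th power of a normalized Dirichlet kernel with about `n / (lam β)` frequencies makes it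
decay away from `t` (`exists_tensor_interpolant`).

Hence `ε` only collects values at nodes of other clusters. These are summed over cubic shells of
width `ρ / N`, each with few nodes; since `β ≥ d + 1` the sum is dominated by `ζ(2)`
(`sum_one_div_wrapDist_pow_le`). By Parseval the Gram entries are bounded by integrals of kernel
powers, of order `(√β lam / N) ^ d` within a cluster and with additional decay between clusters. All
this gives `le_sigmaMin_vandermondeMatrix`, with free kernel order `β`. The two claims are two
choices of `β`: close to `d`, or close to the logarithm of the complexity. -/

/-! ### Gaussian bound for the sine. -/

lemma Real.mul_cos_le_sin {x : ℝ} (h0 : 0 ≤ x) (hx : x ≤ Real.pi) :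
    x * Real.cos x ≤ Real.sin x := by
  have h : AntitoneOn (fun x => x * Real.cos x - Real.sin x) (Set.Icc 0 Real.pi) := by
    apply antitoneOn_of_deriv_nonpos (convex_Icc _ _) (by fun_prop) (by fun_prop)
    intro y hy
    rw [interior_Icc] at hy
    have hd : HasDerivAt (fun x => x * Real.cos x - Real.sin x)
        (1 * Real.cos y + y * (-Real.sin y) - Real.cos y) y :=
      ((hasDerivAt_id y).mul (Real.hasDerivAt_cos y)).sub (Real.hasDerivAt_sin y)
    rw [hd.deriv]
    nlinarith [mul_nonneg hy.1.le (Real.sin_nonneg_of_nonneg_of_le_pi hy.1.le hy.2.le)]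
  have := h (Set.left_mem_Icc.2 Real.pi_pos.le) ⟨h0, hx⟩ h0
  simp at this
  linarith

/-- This is the sign of the derivative of `sinc x * exp (x ^ 2 / 6)`. -/
lemma Real.three_mul_mul_cos_add_sq_mul_sin_le {x : ℝ} (h0 : 0 ≤ x) (hx : x ≤ Real.pi) :
    3 * (x * Real.cos x) + x ^ 2 * Real.sin x ≤ 3 * Real.sin x := by
  have h : AntitoneOn (fun x => 3 * (x * Real.cos x) + x ^ 2 * Real.sin x - 3 * Real.sin x)
      (Set.Icc 0 Real.pi) := by
    apply antitoneOn_of_deriv_nonpos (convex_Icc _ _) (by fun_prop) (by fun_prop)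
    intro y hy
    rw [interior_Icc] at hy
    have hd : HasDerivAt (fun x => 3 * (x * Real.cos x) + x ^ 2 * Real.sin x - 3 * Real.sin x)
        (3 * (1 * Real.cos y + y * (-Real.sin y)) +
          (((2 : ℕ) : ℝ) * y ^ (2 - 1) * Real.sin y + y ^ 2 * Real.cos y)
          - 3 * Real.cos y) y :=
      ((((hasDerivAt_id y).mul (Real.hasDerivAt_cos y)).const_mul 3).add
        ((hasDerivAt_pow 2 y).mul (Real.hasDerivAt_sin y))).sub
          ((Real.hasDerivAt_sin y).const_mul 3)
    rw [hd.deriv]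
    have := mul_nonneg hy.1.le (sub_nonneg.2 (Real.mul_cos_le_sin hy.1.le hy.2.le))
    norm_num
    nlinarith
  have := h (Set.left_mem_Icc.2 Real.pi_pos.le) ⟨h0, hx⟩ h0
  simp at this
  linarith

/-- The Gaussian upper bound for `sin x / x` on `[0, π]`. -/
lemma Real.sin_le_mul_exp_neg {x : ℝ} (h0 : 0 ≤ x) (hx : x ≤ Real.pi) :
    Real.sin x ≤ x * Real.exp (-(x ^ 2 / 6)) := by
  rcases h0.eq_or_lt with rfl | hpos
  · simp
  have h : AntitoneOn (fun x => Real.sinc x * Real.exp (x ^ 2 / 6)) (Set.Icc 0 Real.pi) := by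
    have key : ∀ y ∈ Set.Ioo 0 Real.pi,
        HasDerivAt (fun x => Real.sinc x * Real.exp (x ^ 2 / 6))
          (((Real.cos y * y - Real.sin y * 1) / y ^ 2) * Real.exp (y ^ 2 / 6) +
            Real.sin y / y * (Real.exp (y ^ 2 / 6) * (((2 : ℕ) : ℝ) * y ^ (2 - 1) / 6))) y := by
      intro y hy
      refine HasDerivAt.congr_of_eventuallyEq
        (((Real.hasDerivAt_sin y).div (hasDerivAt_id y) hy.1.ne').mul
          (((hasDerivAt_pow 2 y).div_const 6).exp)) ?_
      filter_upwards [eventually_ne_nhds hy.1.ne'] with z hz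
      simp [Real.sinc_of_ne_zero hz]
    have hc := Real.continuous_sinc
    apply antitoneOn_of_deriv_nonpos (convex_Icc _ _) (by fun_prop)
    · intro y hy
      rw [interior_Icc] at hy
      exact (key y hy).differentiableAt.differentiableWithinAt
    intro y hy
    rw [interior_Icc] at hy
    rw [(key y hy).deriv]
    have h3 := Real.three_mul_mul_cos_add_sq_mul_sin_le hy.1.le hy.2.le
    have hy0 := hy.1.ne'
    have : ((Real.cos y * y - Real.sin y * 1) / y ^ 2) * Real.exp (y ^ 2 / 6) +
            Real.sin y / y * (Real.exp (y ^ 2 / 6) * (((2 : ℕ) : ℝ) * y ^ (2 - 1) / 6)) =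
        Real.exp (y ^ 2 / 6) / (3 * y ^ 2) *
          (3 * (y * Real.cos y) + y ^ 2 * Real.sin y - 3 * Real.sin y) := by
      norm_num
      field_simp
      ring
    rw [this]
    exact mul_nonpos_of_nonneg_of_nonpos (by positivity) (by linarith)
  have := h (Set.left_mem_Icc.2 Real.pi_pos.le) ⟨h0, hx⟩ h0
  simp only [Real.sinc_zero, Real.sinc_of_ne_zero hpos.ne'] at this
  norm_num at this
  rw [div_mul_eq_mul_div, div_le_one hpos] at this
  rw [Real.exp_neg, ← div_eq_mul_inv, le_div_iff₀ (Real.exp_pos _)]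
  exact this

/-! ### Points of the unit circle and the Dirichlet kernel. -/

/-- The point `exp (2πix)` of the unit circle. -/
noncomputable def unitExp (x : ℝ) : ℂ := Complex.exp (Complex.I * ((2 * Real.pi * x : ℝ) : ℂ))

lemma norm_unitExp (x : ℝ) : ‖unitExp x‖ = 1 := Complex.norm_exp_I_mul_ofReal _

lemma unitExp_ne_zero (x : ℝ) : unitExp x ≠ 0 := Complex.exp_ne_zero _

@[fun_prop]
lemma continuous_unitExp : Continuous unitExp := by unfold unitExp; fun_prop

lemma unitExp_add (x y : ℝ) : unitExp (x + y) = unitExp x * unitExp y := by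
  unfold unitExp
  rw [← Complex.exp_add]
  congr 1
  push_cast
  ring

@[simp]
lemma unitExp_zero : unitExp 0 = 1 := by simp [unitExp]

lemma unitExp_neg (x : ℝ) : unitExp (-x) = (unitExp x)⁻¹ := by
  rw [← mul_eq_one_iff_eq_inv₀ (unitExp_ne_zero x), ← unitExp_add]
  simp

lemma conj_unitExp (x : ℝ) : (starRingEnd ℂ) (unitExp x) = unitExp (-x) := by
  rw [unitExp_neg, Complex.inv_eq_conj (norm_unitExp x)]

lemma unitExp_natCast_mul (k : ℕ) (x : ℝ) : unitExp (k * x) = unitExp x ^ k := by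
  unfold unitExp
  rw [← Complex.exp_nat_mul]
  congr 1
  push_cast
  ring

@[simp]
lemma unitExp_intCast (k : ℤ) : unitExp k = 1 := by
  unfold unitExp
  rw [Complex.exp_eq_one_iff]
  exact ⟨k, by push_cast; ring⟩

lemma unitExp_periodic : Function.Periodic unitExp 1 := fun x => by
  rw [unitExp_add]
  have := unitExp_intCast 1
  rw [Int.cast_one] at this
  rw [this, mul_one]

lemma unitExp_sub_intCast (x : ℝ) (k : ℤ) : unitExp (x - k) = unitExp x := by
  rw [sub_eq_add_neg, unitExp_add, unitExp_neg, unitExp_intCast]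
  simp

lemma norm_unitExp_sub_one (x : ℝ) : ‖unitExp x - 1‖ = 2 * |Real.sin (Real.pi * x)| := by
  unfold unitExp
  rw [Complex.norm_exp_I_mul_ofReal_sub_one, norm_mul, Real.norm_eq_abs, Real.norm_eq_abs]
  norm_num
  ring_nf

lemma norm_unitExp_sub (x y : ℝ) : ‖unitExp x - unitExp y‖ = ‖unitExp (x - y) - 1‖ := by
  have : unitExp x - unitExp y = (unitExp (x - y) - 1) * unitExp y := by
    rw [sub_mul, ← unitExp_add]
    simp
  rw [this, norm_mul, norm_unitExp, mul_one]

lemma four_mul_abs_le_norm_unitExp_sub_one {x : ℝ} (hx : |x| ≤ 1 / 2) :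
    4 * |x| ≤ ‖unitExp x - 1‖ := by
  rw [norm_unitExp_sub_one]
  have h : |Real.pi * x| ≤ Real.pi / 2 := by
    rw [abs_mul, abs_of_pos Real.pi_pos]
    nlinarith [Real.pi_pos]
  have := Real.mul_abs_le_abs_sin h
  rw [abs_mul, abs_of_pos Real.pi_pos] at this
  have h2 : 2 / Real.pi * (Real.pi * |x|) = 2 * |x| := by
    field_simp
  linarith

/-- The modulus of the normalized Dirichlet kernel with `m` frequencies. -/
noncomputable def dirichletMean (m : ℕ) (x : ℝ) : ℝ := ‖∑ i ∈ Finset.range m, unitExp x ^ i‖ / m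

lemma dirichletMean_nonneg (m : ℕ) (x : ℝ) : 0 ≤ dirichletMean m x := by
  unfold dirichletMean; positivity

@[fun_prop]
lemma continuous_dirichletMean (m : ℕ) : Continuous (dirichletMean m) := by
  unfold dirichletMean; fun_prop

lemma dirichletMean_periodic (m : ℕ) : Function.Periodic (dirichletMean m) 1 := fun x => by
  simp only [dirichletMean, unitExp_periodic x]

lemma dirichletMean_sub_intCast (m : ℕ) (x : ℝ) (k : ℤ) :
    dirichletMean m (x - k) = dirichletMean m x := by
  simp only [dirichletMean, unitExp_sub_intCast]

lemma dirichletMean_neg (m : ℕ) (x : ℝ) : dirichletMean m (-x) = dirichletMean m x := by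
  unfold dirichletMean
  rw [← Complex.norm_conj (∑ i ∈ Finset.range m, unitExp x ^ i)]
  simp [conj_unitExp]

lemma dirichletMean_le_one (m : ℕ) (x : ℝ) : dirichletMean m x ≤ 1 := by
  unfold dirichletMean
  apply div_le_one_of_le₀ _ (Nat.cast_nonneg _)
  refine (norm_sum_le _ _).trans ?_
  simp [norm_unitExp]

lemma dirichletMean_mul_norm (m : ℕ) (x : ℝ) :
    dirichletMean m x * (m * ‖unitExp x - 1‖) = ‖unitExp (m * x) - 1‖ := by
  rcases Nat.eq_zero_or_pos m with rfl | hm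
  · simp
  have h0 : (m : ℝ) ≠ 0 := by positivity
  rw [unitExp_natCast_mul, ← geom_sum_mul, norm_mul, dirichletMean]
  field_simp

lemma dirichletMean_le_of_abs_le_half {m : ℕ} {x : ℝ} (hm : 0 < m) (hx : |x| ≤ 1 / 2)
    (h0 : x ≠ 0) : dirichletMean m x ≤ 1 / (2 * m * |x|) := by
  have h1 := dirichletMean_mul_norm m x
  have h2 := four_mul_abs_le_norm_unitExp_sub_one hx
  have h3 : ‖unitExp (m * x) - 1‖ ≤ 2 := by
    rw [norm_unitExp_sub_one]
    linarith [Real.abs_sin_le_one (Real.pi * (m * x))]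
  have hxp : 0 < |x| := abs_pos.2 h0
  have hm' : (0 : ℝ) < m := by exact_mod_cast hm
  rw [le_div_iff₀ (by positivity)]
  have h4 := mul_le_mul_of_nonneg_left (mul_le_mul_of_nonneg_left h2 hm'.le)
    (dirichletMean_nonneg m x)
  linarith

lemma dirichletMean_le_of_le_abs_sub_round {m : ℕ} {x δ : ℝ} (hm : 0 < m) (hδ : 0 < δ)
    (h : δ ≤ |x - round x|) : dirichletMean m x ≤ 1 / (2 * m * δ) := by
  rw [← dirichletMean_sub_intCast m x (round x)]
  have hm' : (0 : ℝ) < m := by exact_mod_cast hm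
  refine (dirichletMean_le_of_abs_le_half hm (abs_sub_round x)
    (abs_pos.1 (hδ.trans_le h))).trans ?_
  gcongr

/-- With `y = π x` the kernel is `sin (m y) / (m sin y)`. The numerator obeys the Gaussian bound,
and `sin y ≥ y - y³/6 ≥ y exp (-y²/3)` for `y ≤ 1`; the latter loss turns `m²` into `m² - 2`. -/
lemma dirichletMean_le_exp {m : ℕ} {x : ℝ} (hm : 4 ≤ m) (h0 : 0 ≤ x) (hx : x ≤ 1 / m) :
    dirichletMean m x ≤ Real.exp (-(((m : ℝ) ^ 2 - 2) * (Real.pi * x) ^ 2 / 6)) := by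
  rcases h0.eq_or_lt with rfl | hpos
  · simpa using dirichletMean_le_one m 0
  have hm' : (4 : ℝ) ≤ m := by exact_mod_cast hm
  have hmx : m * x ≤ 1 := by rwa [le_div_iff₀' (by positivity)] at hx
  set y := Real.pi * x with hy
  have hy0 : 0 < y := by positivity
  have hmy : m * y ≤ Real.pi := by
    rw [hy]; nlinarith [Real.pi_pos]
  have hy1 : y ≤ 1 := by nlinarith [Real.pi_lt_four]
  have h1 := dirichletMean_mul_norm m x
  rw [norm_unitExp_sub_one, norm_unitExp_sub_one, ← hy,
    show Real.pi * (m * x) = m * y by rw [hy]; ring,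
    abs_of_nonneg (Real.sin_nonneg_of_nonneg_of_le_pi (by positivity) hmy),
    abs_of_nonneg (Real.sin_nonneg_of_nonneg_of_le_pi hy0.le (by linarith [Real.pi_gt_three]))] at h1
  have h2 := Real.sin_le_mul_exp_neg (x := m * y) (by positivity) hmy
  have h3 := Real.sin_ge_sub_cube hy0.le
  have h4 : y * Real.exp (-(y ^ 2 / 3)) ≤ Real.sin y := by
    refine le_trans ?_ h3
    have : Real.exp (-(y ^ 2 / 3)) ≤ 1 - y ^ 2 / 6 := by
      rw [Real.exp_neg]
      apply inv_le_of_inv_le₀ (by nlinarith)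
      refine le_trans ?_ (Real.add_one_le_exp _)
      rw [inv_eq_one_div, div_le_iff₀ (by nlinarith)]
      nlinarith [mul_nonneg (sq_nonneg y) (sub_nonneg.2 (show y ^ 2 ≤ 1 by nlinarith))]
    nlinarith [mul_le_mul_of_nonneg_left this hy0.le]
  have h5 : dirichletMean m x * (m * (y * Real.exp (-(y ^ 2 / 3)))) ≤
      m * y * Real.exp (-((m * y) ^ 2 / 6)) := by
    have := mul_le_mul_of_nonneg_left (mul_le_mul_of_nonneg_left h4 (show (0:ℝ) ≤ m by positivity))
      (dirichletMean_nonneg m x)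
    linarith
  have h6 : dirichletMean m x * Real.exp (-(y ^ 2 / 3)) ≤ Real.exp (-((m * y) ^ 2 / 6)) := by
    have hp : 0 < m * y := by positivity
    refine le_of_mul_le_mul_left ?_ hp
    linarith
  have h7 : Real.exp (-(((m : ℝ) ^ 2 - 2) * y ^ 2 / 6)) =
      Real.exp (-((m * y) ^ 2 / 6)) / Real.exp (-(y ^ 2 / 3)) := by
    rw [← Real.exp_sub]
    congr 1
    ring
  rw [h7, le_div_iff₀ (Real.exp_pos _)]
  exact h6

/-! ### Moments and correlations of the kernel. -/

lemma integral_dirichletMean_pow_eq (m k : ℕ) :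
    ∫ x in (0:ℝ)..1, dirichletMean m x ^ k = 2 * ∫ x in (0:ℝ)..(1 / 2), dirichletMean m x ^ k := by
  have hc : Continuous fun x => dirichletMean m x ^ k := by fun_prop
  rw [← intervalIntegral.integral_add_adjacent_intervals (b := 1 / 2)
    (hc.intervalIntegrable _ _) (hc.intervalIntegrable _ _)]
  have : ∫ x in (1 / 2 : ℝ)..1, dirichletMean m x ^ k =
      ∫ x in (0:ℝ)..(1 / 2), dirichletMean m x ^ k := by
    have h := intervalIntegral.integral_comp_sub_left (a := 1 / 2) (b := 1)
      (fun x => dirichletMean m x ^ k) (1 : ℝ)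
    norm_num at h
    norm_num
    rw [← h]
    congr 1
    ext x
    rw [← dirichletMean_neg m (1 - x), neg_sub]
    congr 1
    exact_mod_cast (dirichletMean_sub_intCast m x 1).symm
  rw [this]
  ring

/-- Half the period is split at `1 / m`: the Gaussian bound gives the main term on the left, and the
bound `1 / (2 m x)` gives the tail on the right. -/
lemma integral_dirichletMean_pow_le {m g : ℕ} (hm : 4 ≤ m) (hg : 1 ≤ g) :
    ∫ x in (0:ℝ)..1, dirichletMean m x ^ (2 * g) ≤
      √(3 / (Real.pi * g * ((m : ℝ) ^ 2 - 2))) + 2 / ((2 : ℝ) ^ (2 * g) * (2 * g - 1) * m) := by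
  have hm' : (4 : ℝ) ≤ m := by exact_mod_cast hm
  have hg' : (1 : ℝ) ≤ g := by exact_mod_cast hg
  have hm2 : (0 : ℝ) < (m : ℝ) ^ 2 - 2 := by nlinarith
  have hc : Continuous fun x => dirichletMean m x ^ (2 * g) := by fun_prop
  have hmhalf : (1 : ℝ) / m ≤ 1 / 2 := one_div_le_one_div_of_le (by norm_num) (by linarith)
  rw [integral_dirichletMean_pow_eq, ← intervalIntegral.integral_add_adjacent_intervals
    (b := 1 / (m : ℝ)) (hc.intervalIntegrable _ _) (hc.intervalIntegrable _ _), mul_add]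
  apply add_le_add
  · set b : ℝ := g * ((m : ℝ) ^ 2 - 2) * Real.pi ^ 2 / 3 with hb
    have hb0 : 0 < b := by positivity
    have hint := integrable_exp_neg_mul_sq hb0
    have h1 : ∫ x in (0:ℝ)..(1 / m), dirichletMean m x ^ (2 * g) ≤
        ∫ x in (0:ℝ)..(1 / m), Real.exp (-b * x ^ 2) := by
      apply intervalIntegral.integral_mono_on (by positivity) (hc.intervalIntegrable _ _)
        hint.intervalIntegrable
      intro x hx
      refine (pow_le_pow_left₀ (dirichletMean_nonneg m x)
        (dirichletMean_le_exp hm hx.1 hx.2) (2 * g)).trans_eq ?_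
      rw [← Real.exp_nat_mul]
      congr 1
      rw [hb]
      push_cast
      ring
    have h2 : ∫ x in (0:ℝ)..(1 / m), Real.exp (-b * x ^ 2) ≤ √(Real.pi / b) / 2 := by
      rw [← integral_gaussian_Ioi, intervalIntegral.integral_of_le (by positivity)]
      apply MeasureTheory.setIntegral_mono_set hint.integrableOn
      · exact Filter.Eventually.of_forall fun x => (Real.exp_pos _).le
      · exact Filter.Eventually.of_forall fun x hx => hx.1
    have h3 : Real.pi / b = 3 / (Real.pi * g * ((m : ℝ) ^ 2 - 2)) := by
      rw [hb]
      have := Real.pi_pos.ne'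
      field_simp
    rw [h3] at h2
    linarith
  · have h1 : ∫ x in (1 / (m:ℝ))..(1 / 2), dirichletMean m x ^ (2 * g) ≤
        ∫ x in (1 / (m:ℝ))..(1 / 2), (1 / (2 * m)) ^ (2 * g) * x ^ (-(2 * g : ℕ) : ℤ) := by
      apply intervalIntegral.integral_mono_on hmhalf (hc.intervalIntegrable _ _)
      · apply ContinuousOn.intervalIntegrable
        rw [Set.uIcc_of_le hmhalf]
        apply ContinuousOn.mul continuousOn_const
        apply ContinuousOn.zpow₀ continuousOn_id
        intro x hx
        left
        have : 0 < x := lt_of_lt_of_le (by positivity) hx.1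
        exact this.ne'
      intro x hx
      have hx0 : 0 < x := lt_of_lt_of_le (by positivity) hx.1
      have := dirichletMean_le_of_abs_le_half (m := m) (by omega)
        (by rw [abs_of_pos hx0]; exact hx.2) hx0.ne'
      rw [abs_of_pos hx0] at this
      refine (pow_le_pow_left₀ (dirichletMean_nonneg m x) this (2 * g)).trans_eq ?_
      rw [zpow_neg, zpow_natCast, ← inv_pow, ← mul_pow]
      congr 1
      field_simp
    have h2 : ∫ x in (1 / (m:ℝ))..(1 / 2), x ^ (-(2 * g : ℕ) : ℤ) ≤
        (m : ℝ) ^ (2 * g) / (m * (2 * g - 1)) := by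
      rw [integral_zpow]
      · have e1 : (-(2 * g : ℕ) : ℤ) + 1 = -((2 * g - 1 : ℕ) : ℤ) := by
          omega
        have e2 : (((-(2 * g : ℕ) : ℤ) : ℝ) + 1) = -(2 * g - 1) := by push_cast; ring
        rw [e1, e2, zpow_neg, zpow_neg, zpow_natCast, zpow_natCast, ← inv_pow, ← inv_pow,
          one_div, one_div, inv_inv, inv_inv]
        have hgp : (0 : ℝ) < 2 * g - 1 := by linarith
        have e3 : (m : ℝ) ^ (2 * g) = m ^ (2 * g - 1) * m := by
          rw [← pow_succ]; congr 1; omega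
        rw [e3, div_neg, ← neg_div, neg_sub, div_le_div_iff₀ hgp (by positivity)]
        have : (0 : ℝ) ≤ 2 ^ (2 * g - 1) * (m * (2 * g - 1)) := by positivity
        nlinarith
      · right
        refine ⟨by omega, ?_⟩
        rw [Set.uIcc_of_le hmhalf]
        intro h
        have : (0 : ℝ) < 1 / m := by positivity
        linarith [h.1]
    rw [intervalIntegral.integral_const_mul] at h1
    have h3 := mul_le_mul_of_nonneg_left h2 (show (0 : ℝ) ≤ (1 / (2 * m)) ^ (2 * g) by positivity)
    have h4 : (1 / (2 * (m : ℝ))) ^ (2 * g) * ((m : ℝ) ^ (2 * g) / (m * (2 * g - 1))) =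
        1 / ((2 : ℝ) ^ (2 * g) * (2 * g - 1) * m) := by
      have hgp : (2 * (g : ℝ) - 1) ≠ 0 := by
        have : 0 < 2 * (g : ℝ) - 1 := by linarith
        exact this.ne'
      rw [div_pow, mul_pow, one_pow]
      field_simp
    rw [h4] at h3
    calc 2 * _ ≤ 2 * (1 / ((2 : ℝ) ^ (2 * g) * (2 * g - 1) * m)) := by linarith
      _ = _ := by ring

/-- In units of `1 / (m √g)`, `c` bounds the Gaussian part and `t` the tail; `3.1415` stands in for
`π`. -/
lemma integral_dirichletMean_pow_le_of_le {m g : ℕ} {c t : ℝ} (hm : 4 ≤ m) (hg : 1 ≤ g)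
    (hc0 : 0 ≤ c) (hc : 3 * (m : ℝ) ^ 2 ≤ c ^ 2 * (3.1415 * ((m : ℝ) ^ 2 - 2)))
    (ht : 2 * √g ≤ t * ((2 : ℝ) ^ (2 * g) * (2 * g - 1))) :
    ∫ x in (0:ℝ)..1, dirichletMean m x ^ (2 * g) ≤ (c + t) / (m * √g) := by
  have hm' : (4 : ℝ) ≤ m := by exact_mod_cast hm
  have hg' : (1 : ℝ) ≤ g := by exact_mod_cast hg
  have hm2 : (0 : ℝ) < (m : ℝ) ^ 2 - 2 := by nlinarith
  have hgp : (0 : ℝ) < 2 * g - 1 := by linarith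
  have hs : 0 < √(g : ℝ) := Real.sqrt_pos.2 (by linarith)
  refine (integral_dirichletMean_pow_le hm hg).trans ?_
  rw [add_div]
  apply add_le_add
  · apply Real.sqrt_le_iff.2 ⟨by positivity, ?_⟩
    rw [div_pow, mul_pow, Real.sq_sqrt (by positivity), div_le_div_iff₀ (by positivity)
      (by positivity)]
    have : c ^ 2 * (3.1415 * ((m : ℝ) ^ 2 - 2)) ≤ c ^ 2 * (Real.pi * ((m : ℝ) ^ 2 - 2)) := by
      have := Real.pi_gt_d4
      gcongr
    nlinarith
  · rw [div_le_div_iff₀ (by positivity) (by positivity)]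
    nlinarith

lemma sqrt_natCast_le_two_mul_sub_one {g : ℕ} (hg : 1 ≤ g) : √(g : ℝ) ≤ 2 * g - 1 := by
  have hg' : (1 : ℝ) ≤ g := by exact_mod_cast hg
  exact Real.sqrt_le_iff.2 ⟨by linarith, by nlinarith⟩

lemma integral_dirichletMean_pow_le_of_four_le {m g : ℕ} (hm : 2 * g + 1 ≤ m) (hg : 4 ≤ g) :
    ∫ x in (0:ℝ)..1, dirichletMean m x ^ (2 * g) ≤ 1 / (m * √g) := by
  have hm' : (9 : ℝ) ≤ m := by exact_mod_cast (show 9 ≤ m by omega)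
  have h := integral_dirichletMean_pow_le_of_le (m := m) (g := g) (c := 0.99) (t := 0.01)
    (by omega) (by omega) (by norm_num) (by nlinarith) ?_
  · norm_num at h ⊢
    exact h
  have h1 := sqrt_natCast_le_two_mul_sub_one (g := g) (by omega)
  have h2 : (2 : ℝ) ^ (2 * 4) ≤ (2 : ℝ) ^ (2 * g) :=
    pow_le_pow_right₀ (by norm_num) (by omega)
  norm_num at h2
  nlinarith [Real.sqrt_nonneg (g : ℝ)]

/-- Serves the single case `β = 2`, `d = 1`, where the constant `1` of the case `g ≥ 4` is not
available. -/
lemma integral_dirichletMean_pow_four_le {m : ℕ} (hm : 5 ≤ m) :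
    ∫ x in (0:ℝ)..1, dirichletMean m x ^ (2 * 2) ≤ 1.08 / (m * √(2 : ℕ)) := by
  have hm' : (5 : ℝ) ≤ m := by exact_mod_cast hm
  have h := integral_dirichletMean_pow_le_of_le (m := m) (g := 2) (c := 1.02) (t := 0.06)
    (by omega) (by omega) (by norm_num) (by nlinarith) ?_
  · norm_num at h ⊢
    exact h
  have : √((2 : ℕ) : ℝ) ≤ 1.4143 := Real.sqrt_le_iff.2 ⟨by norm_num, by norm_num⟩
  norm_num at this ⊢
  linarith

/-- Used with `g = β / 2` for the moment of order `β`, hence needed from `g = 1` on; there `t = 0.5`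
is exactly what the tail condition demands. -/
lemma integral_dirichletMean_pow_le_crude {m g : ℕ} (hm : 5 ≤ m) (hg : 1 ≤ g) :
    ∫ x in (0:ℝ)..1, dirichletMean m x ^ (2 * g) ≤ 1.52 / (m * √g) := by
  have hm' : (5 : ℝ) ≤ m := by exact_mod_cast hm
  have h := integral_dirichletMean_pow_le_of_le (m := m) (g := g) (c := 1.02) (t := 0.5)
    (by omega) hg (by norm_num) (by nlinarith) ?_
  · norm_num at h ⊢
    exact h
  have h1 := sqrt_natCast_le_two_mul_sub_one hg
  have h2 : (2 : ℝ) ^ (2 * 1) ≤ (2 : ℝ) ^ (2 * g) :=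
    pow_le_pow_right₀ (by norm_num) (by omega)
  norm_num at h2
  nlinarith [Real.sqrt_nonneg (g : ℝ)]

lemma intervalIntegral_dirichletMean_sub_pow (m k : ℕ) (a : ℝ) :
    ∫ x in (0:ℝ)..1, dirichletMean m (x - a) ^ k = ∫ x in (0:ℝ)..1, dirichletMean m x ^ k := by
  rw [intervalIntegral.integral_comp_sub_right (fun x => dirichletMean m x ^ k)]
  have hp : Function.Periodic (fun x => dirichletMean m x ^ k) 1 := fun x => by
    simp only [dirichletMean_periodic m x]
  have := hp.intervalIntegral_add_eq (0 - a) 0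
  rw [show 0 - a + 1 = 1 - a by ring, zero_add] at this
  exact this

/-- Correlations of powers of shifted Dirichlet means are at most the diagonal one. -/
lemma integral_dirichletMean_mul_le (m k : ℕ) (a b : ℝ) :
    ∫ x in (0:ℝ)..1, dirichletMean m (x - a) ^ k * dirichletMean m (x - b) ^ k ≤
      ∫ x in (0:ℝ)..1, dirichletMean m x ^ (2 * k) := by
  have h : ∫ x in (0:ℝ)..1, dirichletMean m (x - a) ^ k * dirichletMean m (x - b) ^ k ≤
      ∫ x in (0:ℝ)..1, (1 / 2 * dirichletMean m (x - a) ^ (2 * k) +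
        1 / 2 * dirichletMean m (x - b) ^ (2 * k)) := by
    apply intervalIntegral.integral_mono_on zero_le_one
    · exact Continuous.intervalIntegrable (by fun_prop) _ _
    · exact Continuous.intervalIntegrable (by fun_prop) _ _
    intro x _
    rw [mul_comm 2 k, pow_mul, pow_mul]
    nlinarith [sq_nonneg (dirichletMean m (x - a) ^ k - dirichletMean m (x - b) ^ k)]
  refine h.trans_eq ?_
  rw [intervalIntegral.integral_add (Continuous.intervalIntegrable (by fun_prop) _ _)
    (Continuous.intervalIntegrable (by fun_prop) _ _), intervalIntegral.integral_const_mul,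
    intervalIntegral.integral_const_mul, intervalIntegral_dirichletMean_sub_pow,
    intervalIntegral_dirichletMean_sub_pow]
  ring

/-- Correlations of powers of Dirichlet means decay with the distance of their centers. -/
lemma integral_dirichletMean_mul_le_of_le_abs_sub_round {m k : ℕ} {a b δ : ℝ} (hm : 0 < m)
    (hδ : 0 < δ) (h : δ ≤ |(a - b) - round (a - b)|) :
    ∫ x in (0:ℝ)..1, dirichletMean m (x - a) ^ k * dirichletMean m (x - b) ^ k ≤
      2 * (1 / (m * δ)) ^ k * ∫ x in (0:ℝ)..1, dirichletMean m x ^ k := by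
  have hm' : (0 : ℝ) < m := by exact_mod_cast hm
  set q : ℝ := (1 / (m * δ)) ^ k with hq
  have hq0 : 0 ≤ q := by positivity
  have key : ∀ y : ℝ, δ / 2 ≤ |y - round y| → dirichletMean m y ^ k ≤ q := fun y hy => by
    refine pow_le_pow_left₀ (dirichletMean_nonneg m y) ?_ k
    refine (dirichletMean_le_of_le_abs_sub_round hm (half_pos hδ) hy).trans_eq ?_
    congr 1
    ring
  have h1 : ∫ x in (0:ℝ)..1, dirichletMean m (x - a) ^ k * dirichletMean m (x - b) ^ k ≤
      ∫ x in (0:ℝ)..1, (q * dirichletMean m (x - a) ^ k + q * dirichletMean m (x - b) ^ k) := by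
    apply intervalIntegral.integral_mono_on zero_le_one
    · exact Continuous.intervalIntegrable (by fun_prop) _ _
    · exact Continuous.intervalIntegrable (by fun_prop) _ _
    intro x _
    have ha := pow_nonneg (dirichletMean_nonneg m (x - a)) k
    have hb := pow_nonneg (dirichletMean_nonneg m (x - b)) k
    -- The centers are at least `δ` apart, so every `x` is at least `δ / 2` away from one of them,
    -- and that factor is at most `q`.
    by_cases hxa : δ / 2 ≤ |(x - a) - round (x - a)|
    · nlinarith [mul_le_mul_of_nonneg_right (key _ hxa) hb]
    · have hxb : δ / 2 ≤ |(x - b) - round (x - b)| := by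
        have h2 := round_le (a - b) (round (x - b) - round (x - a))
        have h3 : |(a - b) - ((round (x - b) - round (x - a) : ℤ) : ℝ)| ≤
            |(x - b) - round (x - b)| + |(x - a) - round (x - a)| := by
          rw [show (a - b) - ((round (x - b) - round (x - a) : ℤ) : ℝ) =
            ((x - b) - round (x - b)) - ((x - a) - round (x - a)) by push_cast; ring]
          exact abs_sub _ _
        linarith
      nlinarith [mul_le_mul_of_nonneg_left (key _ hxb) ha]
  refine h1.trans_eq ?_
  rw [intervalIntegral.integral_add (Continuous.intervalIntegrable (by fun_prop) _ _)
    (Continuous.intervalIntegrable (by fun_prop) _ _), intervalIntegral.integral_const_mul,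
    intervalIntegral.integral_const_mul, intervalIntegral_dirichletMean_sub_pow,
    intervalIntegral_dirichletMean_sub_pow]
  ring

/-! ### The wrap-around distance. -/

lemma wrapDist_eq_norm {d : ℕ} (s t : Fin d → ℝ) :
    wrapDist s t = ‖fun i => (s i - t i) - round (s i - t i)‖ := by
  have hb : BddBelow (Set.range fun r : Fin d → ℤ => ‖s - t + fun i => (r i : ℝ)‖) :=
    ⟨0, by rintro _ ⟨r, rfl⟩; exact norm_nonneg _⟩
  apply le_antisymm
  · refine (ciInf_le hb fun i => -round (s i - t i)).trans_eq ?_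
    congr 1
    ext i
    simp [sub_eq_add_neg]
  · refine le_ciInf fun r => ?_
    rw [pi_norm_le_iff_of_nonneg (norm_nonneg _)]
    intro i
    refine le_trans ?_ (norm_le_pi_norm _ i)
    have := round_le (s i - t i) (-r i)
    simpa [sub_eq_add_neg] using this

lemma abs_sub_round_le_wrapDist {d : ℕ} (s t : Fin d → ℝ) (i : Fin d) :
    |(s i - t i) - round (s i - t i)| ≤ wrapDist s t := by
  rw [wrapDist_eq_norm]
  exact norm_le_pi_norm (fun i => (s i - t i) - round (s i - t i)) i

lemma exists_abs_sub_round_eq_wrapDist {d : ℕ} (hd : 1 ≤ d) (s t : Fin d → ℝ) :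
    ∃ i, |(s i - t i) - round (s i - t i)| = wrapDist s t := by
  have : Nonempty (Fin d) := ⟨⟨0, hd⟩⟩
  obtain ⟨i, hi⟩ := Finite.exists_max fun i => |(s i - t i) - round (s i - t i)|
  refine ⟨i, le_antisymm (abs_sub_round_le_wrapDist s t i) ?_⟩
  rw [wrapDist_eq_norm, pi_norm_le_iff_of_nonneg (abs_nonneg _)]
  exact hi

lemma wrapDist_nonneg {d : ℕ} (s t : Fin d → ℝ) : 0 ≤ wrapDist s t := by
  rw [wrapDist_eq_norm]; exact norm_nonneg _

lemma wrapDist_comm {d : ℕ} (s t : Fin d → ℝ) : wrapDist s t = wrapDist t s := by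
  have h : ∀ s t : Fin d → ℝ, wrapDist s t ≤ wrapDist t s := fun s t => by
    rw [wrapDist_eq_norm, pi_norm_le_iff_of_nonneg (wrapDist_nonneg _ _)]
    intro i
    refine le_trans ?_ (abs_sub_round_le_wrapDist t s i)
    have := round_le (s i - t i) (-round (t i - s i))
    refine this.trans_eq ?_
    rw [← abs_neg]
    congr 1
    push_cast
    ring
  exact le_antisymm (h s t) (h t s)

lemma wrapDist_pos {d : ℕ} {s t : Fin d → ℝ} (hs : ∀ i, s i ∈ Set.Ico (0 : ℝ) 1)
    (ht : ∀ i, t i ∈ Set.Ico (0 : ℝ) 1) (h : s ≠ t) : 0 < wrapDist s t := by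
  obtain ⟨i, hi⟩ := Function.ne_iff.1 h
  refine lt_of_lt_of_le (abs_pos.2 ?_) (abs_sub_round_le_wrapDist s t i)
  intro h0
  have h1 : s i - t i = (round (s i - t i) : ℝ) := by linarith
  obtain ⟨hs0, hs1⟩ := hs i
  obtain ⟨ht0, ht1⟩ := ht i
  have h2 : (-1 : ℝ) < (round (s i - t i) : ℝ) := by linarith
  have h3 : (round (s i - t i) : ℝ) < 1 := by linarith
  have h4 : round (s i - t i) = 0 := by
    have : (-1 : ℤ) < round (s i - t i) := by exact_mod_cast h2
    have : round (s i - t i) < 1 := by exact_mod_cast h3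
    omega
  rw [h4] at h1
  apply hi
  simp at h1
  linarith

lemma IsCluster.wrapDist_le {d N : ℕ} {Λ : Finset (Fin d → ℝ)} (h : IsCluster N Λ)
    {s t : Fin d → ℝ} (hs : s ∈ Λ) (ht : t ∈ Λ) : wrapDist s t ≤ 1 / N := by
  obtain ⟨c, hc⟩ := h
  obtain ⟨r, hr⟩ := hc s hs
  obtain ⟨r', hr'⟩ := hc t ht
  rw [wrapDist_eq_norm, pi_norm_le_iff_of_nonneg (by positivity)]
  intro i
  refine (round_le (s i - t i) (r' i - r i)).trans ?_
  have h1 := hr i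
  have h2 := hr' i
  push_cast
  rw [abs_le]
  constructor <;> linarith [h1.1, h1.2, h2.1, h2.2]

/-! ### Parseval and localized interpolants. -/

lemma integral_unitExp_intCast_mul (k : ℤ) :
    ∫ x in (0:ℝ)..1, unitExp (k * x) = if k = 0 then 1 else 0 := by
  split_ifs with h
  · simp [h]
  · have hc : (2 * Real.pi * k * Complex.I : ℂ) ≠ 0 := by
      simp [h, Real.pi_ne_zero]
    have h1 : ∀ x : ℝ, unitExp (k * x) = Complex.exp ((2 * Real.pi * k * Complex.I : ℂ) * x) := by
      intro x
      unfold unitExp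
      congr 1
      push_cast
      ring
    simp_rw [h1]
    rw [integral_exp_mul_complex hc]
    have h2 := unitExp_intCast k
    have h3 := h1 1
    rw [mul_one, h2] at h3
    rw [← h3]
    simp

open Polynomial in
/-- The inner product of coefficient vectors is bounded by the integral over the circle. -/
lemma norm_sum_conj_coeff_mul_coeff_le {n : ℕ} {p q : ℂ[X]} (hp : p.natDegree ≤ n)
    (hq : q.natDegree ≤ n) :
    ‖∑ k : Fin (n + 1), (starRingEnd ℂ) (p.coeff k) * q.coeff k‖ ≤
      ∫ x in (0:ℝ)..1, ‖p.eval (unitExp x)‖ * ‖q.eval (unitExp x)‖ := by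
  have key : ∑ k : Fin (n + 1), (starRingEnd ℂ) (p.coeff k) * q.coeff k =
      ∫ x in (0:ℝ)..1, (starRingEnd ℂ) (p.eval (unitExp x)) * q.eval (unitExp x) := by
    have h1 : ∀ x : ℝ, (starRingEnd ℂ) (p.eval (unitExp x)) * q.eval (unitExp x) =
        ∑ k ∈ Finset.range (n + 1), ∑ l ∈ Finset.range (n + 1),
          ((starRingEnd ℂ) (p.coeff k) * q.coeff l) * unitExp (((l - k : ℤ) : ℝ) * x) := by
      intro x
      rw [eval_eq_sum_range' (Nat.lt_succ_of_le hp), eval_eq_sum_range' (Nat.lt_succ_of_le hq),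
        map_sum, Finset.sum_mul_sum]
      refine Finset.sum_congr rfl fun k _ => Finset.sum_congr rfl fun l _ => ?_
      rw [map_mul, map_pow, conj_unitExp, ← unitExp_natCast_mul, ← unitExp_natCast_mul]
      rw [show ((l - k : ℤ) : ℝ) * x = k * -x + l * x by push_cast; ring, unitExp_add]
      ring
    simp_rw [h1]
    rw [intervalIntegral.integral_finsetSum
      (fun k _ => Continuous.intervalIntegrable (by fun_prop) _ _)]
    rw [Fin.sum_univ_eq_sum_range (fun k => (starRingEnd ℂ) (p.coeff k) * q.coeff k) (n + 1)]
    refine Finset.sum_congr rfl fun k hk => ?_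
    rw [intervalIntegral.integral_finsetSum
      (fun l _ => Continuous.intervalIntegrable (by fun_prop) _ _)]
    simp_rw [intervalIntegral.integral_const_mul, integral_unitExp_intCast_mul, sub_eq_zero,
      Nat.cast_inj]
    simp only [mul_ite, mul_one, mul_zero]
    rw [Finset.sum_ite_eq' _ k, if_pos hk]
  rw [key]
  refine (intervalIntegral.norm_integral_le_integral_norm zero_le_one).trans_eq ?_
  simp

open Polynomial in
/-- A univariate interpolant that is `1` at `a`, vanishes at the `b i`, and is localized at `a`. -/
lemma exists_polynomial_interpolant {ι : Type*} {m M β n : ℕ} (hm : 0 < m) (a : ℝ) (s : Finset ι)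
    (b : ι → ℝ) (hdeg : M * s.card + β * (m - 1) ≤ n)
    (hM : 0 < M) (hpos : ∀ i ∈ s, 0 < |(a - b i) - round (a - b i)|)
    (hle : ∀ i ∈ s, M * |(a - b i) - round (a - b i)| ≤ 1 / 2) :
    ∃ p : ℂ[X], p.natDegree ≤ n ∧ p.eval (unitExp a) = 1 ∧
      (∀ i ∈ s, p.eval (unitExp (b i)) = 0) ∧
      ∀ x, ‖p.eval (unitExp x)‖ ≤
        (∏ i ∈ s, 1 / (2 * M * |(a - b i) - round (a - b i)|)) * dirichletMean m (x - a) ^ β := by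
  have hm' : (m : ℂ) ≠ 0 := by exact_mod_cast hm.ne'
  have hM' : (0 : ℝ) < M := by exact_mod_cast hM
  -- Using `X ^ M` instead of `X` magnifies the node gap by `M`. As long as `M` times the gap is at
  -- most `1 / 2` there is no wrapping, so `‖w i‖` is at least four times the magnified gap, against
  -- a numerator of at most `2`.
  set w : ι → ℂ := fun i => unitExp (M * a) - unitExp (M * b i) with hw
  have hwn : ∀ i ∈ s, 4 * (M * |(a - b i) - round (a - b i)|) ≤ ‖w i‖ := by
    intro i hi
    rw [hw]
    simp only
    rw [norm_unitExp_sub]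
    have h1 : (M * a - M * b i : ℝ) =
        M * ((a - b i) - round (a - b i)) - ((-(M * round (a - b i)) : ℤ) : ℝ) := by
      push_cast; ring
    rw [h1, unitExp_sub_intCast]
    have h2 : |(M : ℝ) * ((a - b i) - round (a - b i))| = M * |(a - b i) - round (a - b i)| := by
      rw [abs_mul, abs_of_pos hM']
    rw [← h2]
    apply four_mul_abs_le_norm_unitExp_sub_one
    rw [h2]
    exact hle i hi
  have hw0 : ∀ i ∈ s, w i ≠ 0 := fun i hi => by
    have := hwn i hi
    have h2 := hpos i hi
    rw [← norm_pos_iff]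
    exact lt_of_lt_of_le (by positivity) this
  set L : ℂ[X] := ∏ i ∈ s, (C (w i)⁻¹ * (X ^ M - C (unitExp (M * b i)))) with hL
  set K : ℂ[X] := (C ((m : ℂ)⁻¹) * ∑ i ∈ Finset.range m, (C (unitExp (-a)) * X) ^ i) ^ β with hK
  have hLe : ∀ x, L.eval (unitExp x) =
      ∏ i ∈ s, ((w i)⁻¹ * (unitExp (M * x) - unitExp (M * b i))) := by
    intro x
    simp [hL, eval_prod, unitExp_natCast_mul]
  have hKe : ∀ x, K.eval (unitExp x) =
      ((m : ℂ)⁻¹ * ∑ i ∈ Finset.range m, unitExp (x - a) ^ i) ^ β := by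
    intro x
    have h : unitExp (x - a) = unitExp (-a) * unitExp x := by
      rw [← unitExp_add]
      congr 1
      ring
    rw [hK, h]
    simp only [eval_pow, eval_mul, eval_C, eval_finsetSum, eval_X]
  refine ⟨L * K, ?_, ?_, ?_, ?_⟩
  · refine natDegree_mul_le.trans ((add_le_add ?_ ?_).trans hdeg)
    · refine (natDegree_prod_le _ _).trans ?_
      refine (Finset.sum_le_card_nsmul _ _ M fun i _ => ?_).trans_eq (by simp [mul_comm])
      refine (natDegree_C_mul_le _ _).trans ?_
      exact (natDegree_sub_C).le.trans (natDegree_X_pow_le M)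
    · refine natDegree_pow_le.trans ?_
      refine Nat.mul_le_mul_left _ ?_
      refine (natDegree_C_mul_le _ _).trans ?_
      refine natDegree_sum_le_of_forall_le _ _ fun i hi => ?_
      refine natDegree_pow_le.trans ?_
      have h1 : (C (unitExp (-a)) * X : ℂ[X]).natDegree ≤ 1 :=
        (natDegree_C_mul_le _ _).trans natDegree_X_le
      have h2 := Finset.mem_range.1 hi
      calc _ ≤ i * 1 := Nat.mul_le_mul_left _ h1
        _ ≤ m - 1 := by omega
  · rw [eval_mul, hLe, hKe]
    rw [Finset.prod_eq_one fun i hi => inv_mul_cancel₀ (hw0 i hi)]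
    simp [hm']
  · intro i hi
    rw [eval_mul, hLe, Finset.prod_eq_zero hi (by simp), zero_mul]
  · intro x
    rw [eval_mul, hLe, hKe, norm_mul, norm_prod]
    have h1 : ‖((m : ℂ)⁻¹ * ∑ i ∈ Finset.range m, unitExp (x - a) ^ i) ^ β‖ =
        dirichletMean m (x - a) ^ β := by
      rw [norm_pow, norm_mul, dirichletMean, norm_inv, Complex.norm_natCast, div_eq_inv_mul]
    rw [h1]
    refine mul_le_mul_of_nonneg_right ?_ (pow_nonneg (dirichletMean_nonneg _ _) _)
    refine Finset.prod_le_prod (fun i _ => norm_nonneg _) fun i hi => ?_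
    have h2 := hpos i hi
    have h3 := hwn i hi
    have h4 : ‖unitExp (M * x) - unitExp (M * b i)‖ ≤ 2 := by
      refine (norm_sub_le _ _).trans ?_
      rw [norm_unitExp, norm_unitExp]
      norm_num
    rw [norm_mul, norm_inv, inv_mul_eq_div]
    calc _ ≤ 2 / (4 * (M * |(a - b i) - round (a - b i)|)) := by gcongr
      _ = _ := by field_simp; norm_num

open Polynomial in
/-- Tensor product interpolants, localized at the node `t`. -/
lemma exists_tensor_interpolant {d m M β n : ℕ} (hd : 1 ≤ d) (hm : 0 < m) (hM : 0 < M)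
    (t : Fin d → ℝ) (S : Finset (Fin d → ℝ)) (hdeg : M * S.card + β * (m - 1) ≤ n)
    (hpos : ∀ t' ∈ S, 0 < wrapDist t t') (hle : ∀ t' ∈ S, M * wrapDist t t' ≤ 1 / 2) :
    ∃ (u : Fin d → ℂ[X]) (P : Fin d → ℝ), (∀ j, (u j).natDegree ≤ n) ∧ (∀ j, 0 ≤ P j) ∧
      ∏ j, P j = ∏ t' ∈ S, 1 / (2 * M * wrapDist t t') ∧
      (∀ j x, ‖(u j).eval (unitExp x)‖ ≤ P j * dirichletMean m (x - t j) ^ β) ∧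
      ∏ j, (u j).eval (unitExp (t j)) = 1 ∧
      ∀ t' ∈ S, ∏ j, (u j).eval (unitExp (t' j)) = 0 := by
  -- Each node of `S` is cancelled in only one coordinate, one where its distance to `t` is
  -- attained. The fibres of `J` partition `S`, so each node contributes exactly one factor to the
  -- total constant.
  choose J hJ using fun t' => exists_abs_sub_round_eq_wrapDist hd t t'
  have hmem : ∀ j, ∀ t' ∈ S.filter (J · = j),
      t' ∈ S ∧ |(t j - t' j) - round (t j - t' j)| = wrapDist t t' := by
    intro j t' ht'
    rw [Finset.mem_filter] at ht'
    refine ⟨ht'.1, ?_⟩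
    rw [← ht'.2]
    exact hJ t'
  have := fun j => exists_polynomial_interpolant (M := M) (β := β) (n := n) hm (t j)
    (S.filter (J · = j)) (fun t' => t' j)
    ((Nat.add_le_add_right (Nat.mul_le_mul_left _ (Finset.card_filter_le _ _)) _).trans hdeg) hM
    (fun t' ht' => by rw [(hmem j t' ht').2]; exact hpos t' (hmem j t' ht').1)
    (fun t' ht' => by rw [(hmem j t' ht').2]; exact hle t' (hmem j t' ht').1)
  choose u hu1 hu2 hu3 hu4 using this
  refine ⟨u, fun j => ∏ t' ∈ S.filter (J · = j), 1 / (2 * M * wrapDist t t'), hu1, ?_, ?_, ?_,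
    ?_, ?_⟩
  · exact fun j => Finset.prod_nonneg fun t' _ =>
      div_nonneg zero_le_one (mul_nonneg (by positivity) (wrapDist_nonneg _ _))
  · exact Finset.prod_fiberwise S J _
  · intro j x
    refine (hu4 j x).trans_eq ?_
    congr 1
    exact Finset.prod_congr rfl fun t' ht' => by rw [(hmem j t' ht').2]
  · exact Finset.prod_eq_one fun j _ => hu2 j
  · intro t' ht'
    exact Finset.prod_eq_zero (Finset.mem_univ (J t'))
      (hu3 (J t') t' (Finset.mem_filter.2 ⟨ht', rfl⟩))

/-! ### Counting distant nodes in shells. -/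

lemma add_one_pow_le_pow_add {x : ℝ} (hx : 1 ≤ x) {d : ℕ} (hd : 1 ≤ d) :
    (x + 1) ^ d ≤ x ^ d + (2 ^ d - 1) * x ^ (d - 1) := by
  induction d, hd using Nat.le_induction with
  | base => norm_num
  | succ d hd ih =>
    obtain ⟨k, rfl⟩ : ∃ k, d = k + 1 := ⟨d - 1, by omega⟩
    simp only [Nat.add_sub_cancel] at ih ⊢
    have h1 : (1 : ℝ) ≤ 2 ^ (k + 1) := one_le_pow₀ (by norm_num)
    have h2 : x ^ k ≤ x ^ (k + 1) := pow_le_pow_right₀ hx (Nat.le_succ k)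
    calc (x + 1) ^ (k + 1 + 1) = (x + 1) ^ (k + 1) * (x + 1) := pow_succ _ _
      _ ≤ (x ^ (k + 1) + (2 ^ (k + 1) - 1) * x ^ k) * (x + 1) := by gcongr
      _ = x ^ (k + 1 + 1) + x ^ (k + 1) + (2 ^ (k + 1) - 1) * x ^ (k + 1)
          + (2 ^ (k + 1) - 1) * x ^ k := by ring
      _ ≤ x ^ (k + 1 + 1) + x ^ (k + 1) + (2 ^ (k + 1) - 1) * x ^ (k + 1)
          + (2 ^ (k + 1) - 1) * x ^ (k + 1) := by
        have := mul_le_mul_of_nonneg_left h2 (sub_nonneg.2 h1)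
        linarith
      _ = _ := by ring

lemma abs_sub_lt_of_floor_eq {x y δ : ℝ} (hδ : 0 < δ) (hs : (0 ≤ x) ↔ (0 ≤ y))
    (hf : ⌊|x| / δ⌋₊ = ⌊|y| / δ⌋₊) : |x - y| < δ := by
  have h1 := Nat.floor_le (div_nonneg (abs_nonneg x) hδ.le)
  have h2 := Nat.lt_floor_add_one (|x| / δ)
  have h3 := Nat.floor_le (div_nonneg (abs_nonneg y) hδ.le)
  have h4 := Nat.lt_floor_add_one (|y| / δ)
  rw [← hf] at h3 h4
  rw [le_div_iff₀ hδ] at h1 h3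
  rw [div_lt_iff₀ hδ] at h2 h4
  have h5 : |(|x| - |y|)| < δ := by
    rw [abs_lt]; constructor <;> linarith
  by_cases hx : 0 ≤ x
  · rwa [abs_of_nonneg hx, abs_of_nonneg (hs.1 hx)] at h5
  · have hy : ¬ 0 ≤ y := fun h => hx (hs.2 h)
    rw [abs_of_neg (not_le.1 hx), abs_of_neg (not_le.1 hy)] at h5
    rwa [← abs_neg, show -(x - y) = -x - -y by ring]

/-- If at most `lam` nodes of `S` can be pairwise closer than `δ`, then the shell
`j δ ≤ dist < (j + 1) δ` around `t` has at most `lam 2^d ((j + 1)^d - j^d)` nodes. -/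
lemma card_shell_le {d lam : ℕ} (hd : 1 ≤ d) {δ : ℝ} (hδ : 0 < δ) (t : Fin d → ℝ)
    (S : Finset (Fin d → ℝ))
    (hS : ∀ U ⊆ S, (∀ a ∈ U, ∀ b ∈ U, wrapDist a b < δ) → U.card ≤ lam) (j : ℕ) :
    (S.filter fun t' => ⌊wrapDist t t' / δ⌋₊ = j).card ≤
      lam * (2 ^ d * ((j + 1) ^ d - j ^ d)) := by
  classical
  set y : (Fin d → ℝ) → Fin d → ℝ := fun t' i => (t i - t' i) - round (t i - t' i) with hy
  -- The offset space is cut into cubes of side `δ`, labelled by signs and by integer parts of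
  -- absolute values. Two nodes in one cube are closer than `δ`, so a cube holds at most `lam`
  -- nodes.
  set cell : (Fin d → ℝ) → (Fin d → Bool) × (Fin d → ℕ) := fun t' =>
    (fun i => decide (0 ≤ y t' i), fun i => ⌊|y t' i| / δ⌋₊) with hcell
  set W := S.filter fun t' => ⌊wrapDist t t' / δ⌋₊ = j with hW
  have h1 : W.card ≤ lam * (W.image cell).card := by
    apply Finset.card_le_mul_card_image
    intro z _
    apply hS
    · exact (Finset.filter_subset _ _).trans (Finset.filter_subset _ _)
    intro a ha b hb
    have hab : cell a = cell b :=
      (Finset.mem_filter.1 ha).2.trans (Finset.mem_filter.1 hb).2.symm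
    rw [wrapDist_eq_norm, pi_norm_lt_iff hδ]
    intro i
    have hs : (0 ≤ y a i) ↔ (0 ≤ y b i) := by
      have := congrFun (congrArg Prod.fst hab) i
      simpa [hcell] using this
    have hf : ⌊|y a i| / δ⌋₊ = ⌊|y b i| / δ⌋₊ := congrFun (congrArg Prod.snd hab) i
    refine lt_of_le_of_lt ?_ (abs_sub_lt_of_floor_eq hδ hs hf)
    refine (round_le (a i - b i) (round (t i - b i) - round (t i - a i))).trans_eq ?_
    rw [← abs_neg]
    congr 1
    simp only [hy]
    push_cast
    ring
  -- In shell `j` the largest integer part equals `j`: labels lie in the box of side `j + 1` but not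
  -- in the box of side `j`.
  have h2 : W.image cell ⊆ Finset.univ ×ˢ
      (Fintype.piFinset (fun _ : Fin d => Finset.range (j + 1)) \
        Fintype.piFinset (fun _ : Fin d => Finset.range j)) := by
    intro z hz
    obtain ⟨t', ht', rfl⟩ := Finset.mem_image.1 hz
    have hj := (Finset.mem_filter.1 ht').2
    simp only [Finset.mem_product, Finset.mem_univ, true_and, Finset.mem_sdiff,
      Fintype.mem_piFinset, Finset.mem_range, hcell]
    constructor
    · intro i
      rw [Nat.lt_succ_iff, ← hj]
      apply Nat.floor_le_floor
      have := abs_sub_round_le_wrapDist t t' i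
      gcongr
    · intro h
      obtain ⟨i, hi⟩ := exists_abs_sub_round_eq_wrapDist hd t t'
      have := h i
      simp only [hy, hi, hj] at this
      exact lt_irrefl _ this
  have h3 := Finset.card_le_card h2
  rw [Finset.card_product, Finset.card_sdiff_of_subset] at h3
  · simp only [Finset.card_univ, Fintype.card_piFinset, Finset.card_range, Finset.prod_const,
      Fintype.card_pi, Fintype.card_bool, Fintype.card_fin] at h3
    exact h1.trans (Nat.mul_le_mul_left _ h3)
  · exact Fintype.piFinset_subset _ _ fun _ => Finset.range_mono (Nat.le_succ j)

lemma sum_one_div_wrapDist_pow_le {d lam β : ℕ} (hd : 1 ≤ d) (hβ : d + 1 ≤ β) {δ : ℝ} (hδ : 0 < δ)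
    (t : Fin d → ℝ) (S : Finset (Fin d → ℝ)) (hfar : ∀ t' ∈ S, δ ≤ wrapDist t t')
    (hS : ∀ U ⊆ S, (∀ a ∈ U, ∀ b ∈ U, wrapDist a b < δ) → U.card ≤ lam) :
    ∑ t' ∈ S, (1 / wrapDist t t') ^ β ≤
      lam * (2 ^ d * (2 ^ d - 1) * (Real.pi ^ 2 / 6) * (1 / δ) ^ β) := by
  classical
  set J : (Fin d → ℝ) → ℕ := fun t' => ⌊wrapDist t t' / δ⌋₊ with hJ
  have hJ1 : ∀ t' ∈ S, 1 ≤ J t' := fun t' ht' => by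
    rw [hJ, Nat.one_le_floor_iff, one_le_div hδ]
    exact hfar t' ht'
  have h2d : (1 : ℝ) ≤ 2 ^ d := one_le_pow₀ (by norm_num)
  set q : ℝ := 2 ^ d * (2 ^ d - 1) with hq
  have hq0 : 0 ≤ q := mul_nonneg (by positivity) (by linarith)
  calc ∑ t' ∈ S, (1 / wrapDist t t') ^ β ≤ ∑ t' ∈ S, (1 / (J t' * δ)) ^ β := by
        refine Finset.sum_le_sum fun t' ht' => ?_
        have h1 : (0 : ℝ) < J t' := by exact_mod_cast hJ1 t' ht'
        have h2 : J t' * δ ≤ wrapDist t t' := by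
          rw [← le_div_iff₀ hδ]
          exact Nat.floor_le (div_nonneg (wrapDist_nonneg _ _) hδ.le)
        have h3 := hδ.trans_le (hfar t' ht')
        gcongr
    _ = ∑ j ∈ S.image J, (S.filter fun t' => J t' = j).card • (1 / ((j : ℝ) * δ)) ^ β :=
        Finset.sum_comp (fun j : ℕ => (1 / ((j : ℝ) * δ)) ^ β) J
    _ ≤ ∑ j ∈ S.image J, (lam * q * (1 / δ) ^ β) * (1 / (j : ℝ) ^ 2) := by
        refine Finset.sum_le_sum fun j hj => ?_
        obtain ⟨t', ht', rfl⟩ := Finset.mem_image.1 hj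
        have hj1 := hJ1 t' ht'
        generalize J t' = j at *
        have hj1' : (1 : ℝ) ≤ j := by exact_mod_cast hj1
        have h1 := card_shell_le hd hδ t S hS j
        have h2 : ((S.filter fun t' => J t' = j).card : ℝ) ≤ lam * (q * (j : ℝ) ^ (d - 1)) := by
          have h3 : ((S.filter fun t' => J t' = j).card : ℝ) ≤
              ((lam * (2 ^ d * ((j + 1) ^ d - j ^ d)) : ℕ) : ℝ) := by exact_mod_cast h1
          refine h3.trans ?_
          rw [Nat.cast_mul, Nat.cast_mul, Nat.cast_sub (Nat.pow_le_pow_left (Nat.le_succ j) d)]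
          push_cast
          have h4 := add_one_pow_le_pow_add hj1' hd
          rw [hq, mul_assoc (2 ^ d : ℝ)]
          gcongr
          linarith
        rw [nsmul_eq_mul]
        -- The hypothesis `d + 1 ≤ β` enters here: the shell count grows like `j ^ (d - 1)`, leaving
        -- at least the decay `j ^ (-2)`.
        have h5 : (j : ℝ) ^ (d - 1) * (j : ℝ) ^ 2 ≤ (j : ℝ) ^ β := by
          rw [← pow_add]
          exact pow_le_pow_right₀ hj1' (by omega)
        calc _ ≤ lam * (q * (j : ℝ) ^ (d - 1)) * (1 / ((j : ℝ) * δ)) ^ β := by gcongr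
          _ = (lam * q * (1 / δ) ^ β) * ((j : ℝ) ^ (d - 1) / (j : ℝ) ^ β) := by
            rw [div_pow, div_pow, mul_pow, one_pow]
            field_simp
          _ ≤ _ := by
            refine mul_le_mul_of_nonneg_left ?_ (by positivity)
            rw [div_le_div_iff₀ (by positivity) (by positivity)]
            linarith
    _ = (lam * q * (1 / δ) ^ β) * ∑ j ∈ S.image J, 1 / (j : ℝ) ^ 2 := by rw [Finset.mul_sum]
    _ ≤ (lam * q * (1 / δ) ^ β) * (Real.pi ^ 2 / 6) := by
        refine mul_le_mul_of_nonneg_left ?_ (by positivity)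
        exact sum_le_hasSum _ (fun j _ => by positivity) hasSum_zeta_two
    _ = _ := by ring

/-! ### Schur test and duality. -/

/-- The Schur test: `a i * a j ≤ (a i ^ 2 + a j ^ 2) / 2`, and by symmetry both halves reduce to row
sums. -/
lemma sum_sum_mul_le_of_row_sum_le {ι : Type*} [Fintype ι] {h : ι → ι → ℝ} {R : ℝ}
    (h0 : ∀ i j, 0 ≤ h i j) (hsymm : ∀ i j, h i j = h j i) (hR : ∀ i, ∑ j, h i j ≤ R)
    (a : ι → ℝ) : ∑ i, ∑ j, h i j * (a i * a j) ≤ R * ∑ i, a i ^ 2 := by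
  have h1 : ∑ i, ∑ j, h i j * (a i * a j) ≤
      ∑ i, ∑ j, (h i j * (a i ^ 2 / 2) + h i j * (a j ^ 2 / 2)) := by
    refine Finset.sum_le_sum fun i _ => Finset.sum_le_sum fun j _ => ?_
    rw [← mul_add]
    exact mul_le_mul_of_nonneg_left (by nlinarith [sq_nonneg (a i - a j)]) (h0 i j)
  have h2 : ∑ i, ∑ j, h i j * (a j ^ 2 / 2) = ∑ i, ∑ j, h i j * (a i ^ 2 / 2) := by
    rw [Finset.sum_comm]
    exact Finset.sum_congr rfl fun i _ => Finset.sum_congr rfl fun j _ => by rw [hsymm]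
  refine h1.trans ?_
  simp_rw [Finset.sum_add_distrib]
  rw [h2, ← Finset.sum_add_distrib, Finset.mul_sum]
  refine Finset.sum_le_sum fun i _ => ?_
  rw [← Finset.sum_mul]
  nlinarith [mul_le_mul_of_nonneg_right (hR i) (sq_nonneg (a i))]

/-- Approximately dual vectors with almost orthogonal Gram matrix bound `sigmaMin` from below. -/
lemma le_sigmaMin_of_approx_dual {m k : Type*} [Fintype m] [Fintype k] [Nonempty m]
    [DecidableEq m] (A : Matrix m k ℂ) (c : m → k → ℂ) {h g : m → m → ℝ} {ε G : ℝ} (hG : 0 < G)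
    (hsymm : ∀ s t, h s t = h t s) (hrow : ∀ t, ∑ s, h t s ≤ ε)
    (hdual : ∀ t s, ‖A.mulVec (c t) s - if s = t then 1 else 0‖ ≤ h t s)
    (gsymm : ∀ s t, g s t = g t s) (grow : ∀ t, ∑ s, g t s ≤ G)
    (hgram : ∀ t s, ‖∑ α, (starRingEnd ℂ) (c t α) * c s α‖ ≤ g t s) :
    (1 - ε) / √G ≤ sigmaMin A := by
  have : Nonempty (Metric.sphere (0 : EuclideanSpace ℂ m) 1) := by
    obtain ⟨i⟩ := ‹Nonempty m›
    exact ⟨⟨EuclideanSpace.single i 1, by simp⟩⟩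
  refine le_ciInf fun v => ?_
  obtain ⟨v, hv⟩ := v
  rw [mem_sphere_zero_iff_norm] at hv
  have hv2 : ∑ t, ‖v.ofLp t‖ ^ 2 = 1 := by
    rw [← EuclideanSpace.norm_sq_eq, hv, one_pow]
  rw [div_le_iff₀ (Real.sqrt_pos.2 hG)]
  set w := A.conjTranspose.mulVec v.ofLp with hw
  -- The test vector for `A^* v`: its norm is controlled by the Gram matrix, and its pairing with
  -- `A^* v` by the approximate duality.
  set f : k → ℂ := fun α => ∑ t, v.ofLp t * c t α with hf
  have hfn : ‖WithLp.toLp 2 f‖ ≤ √G := by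
    apply Real.le_sqrt_of_sq_le
    have e1 : ((‖WithLp.toLp 2 f‖ ^ 2 : ℝ) : ℂ) =
        ∑ t, ∑ s, ((starRingEnd ℂ) (v.ofLp t) * v.ofLp s) *
          ∑ α, (starRingEnd ℂ) (c t α) * c s α := by
      rw [EuclideanSpace.norm_sq_eq]
      push_cast
      have e2 : ∀ α, ((‖f α‖ : ℂ)) ^ 2 = ∑ t, ∑ s, ((starRingEnd ℂ) (v.ofLp t) * v.ofLp s) *
          ((starRingEnd ℂ) (c t α) * c s α) := fun α => by
        rw [← Complex.conj_mul', hf]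
        simp only
        rw [map_sum, Finset.sum_mul_sum]
        refine Finset.sum_congr rfl fun t _ => Finset.sum_congr rfl fun s _ => ?_
        rw [map_mul]
        ring
      simp_rw [e2, Finset.mul_sum]
      rw [Finset.sum_comm]
      exact Finset.sum_congr rfl fun t _ => Finset.sum_comm
    have e3 : ‖WithLp.toLp 2 f‖ ^ 2 = ‖((‖WithLp.toLp 2 f‖ ^ 2 : ℝ) : ℂ)‖ := by
      rw [Complex.norm_real, Real.norm_of_nonneg (by positivity)]
    rw [e3, e1]
    refine (norm_sum_le _ _).trans ?_
    calc _ ≤ ∑ t, ∑ s, g t s * (‖v.ofLp t‖ * ‖v.ofLp s‖) := by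
          refine Finset.sum_le_sum fun t _ => (norm_sum_le _ _).trans ?_
          refine Finset.sum_le_sum fun s _ => ?_
          rw [norm_mul, norm_mul, RCLike.norm_conj, mul_comm]
          exact mul_le_mul_of_nonneg_right (hgram t s) (by positivity)
      _ ≤ G * ∑ t, ‖v.ofLp t‖ ^ 2 := sum_sum_mul_le_of_row_sum_le
          (fun t s => (norm_nonneg _).trans (hgram t s)) gsymm grow _
      _ = G := by rw [hv2, mul_one]
  have hAf : ∀ s, A.mulVec f s = ∑ t, v.ofLp t * A.mulVec (c t) s := fun s => by
    simp only [Matrix.mulVec, dotProduct, hf, Finset.mul_sum]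
    rw [Finset.sum_comm]
    exact Finset.sum_congr rfl fun t _ => Finset.sum_congr rfl fun α _ => by ring
  have hpair : ∑ s, (starRingEnd ℂ) (v.ofLp s) * A.mulVec f s = inner ℂ (WithLp.toLp 2 w)
      (WithLp.toLp 2 f) := by
    rw [EuclideanSpace.inner_eq_star_dotProduct]
    simp only [hw]
    rw [Matrix.star_mulVec, Matrix.conjTranspose_conjTranspose, dotProduct_comm,
      ← Matrix.dotProduct_mulVec]
    simp [dotProduct]
  have hlow : 1 - ε ≤ ‖∑ s, (starRingEnd ℂ) (v.ofLp s) * A.mulVec f s‖ := by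
    have e1 : ∑ s, (starRingEnd ℂ) (v.ofLp s) * A.mulVec f s = 1 +
        ∑ t, ∑ s, ((starRingEnd ℂ) (v.ofLp s) * v.ofLp t) *
          (A.mulVec (c t) s - if s = t then 1 else 0) := by
      have e2 : ∑ t, ∑ s, ((starRingEnd ℂ) (v.ofLp s) * v.ofLp t) *
          (if s = t then (1 : ℂ) else 0) = 1 := by
        simp only [mul_ite, mul_one, mul_zero, Finset.sum_ite_eq', Finset.mem_univ, if_true,
          Complex.conj_mul']
        exact_mod_cast hv2
      simp_rw [mul_sub, Finset.sum_sub_distrib]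
      rw [e2, add_sub_cancel]
      simp_rw [hAf, Finset.mul_sum]
      rw [Finset.sum_comm]
      exact Finset.sum_congr rfl fun t _ => Finset.sum_congr rfl fun s _ => by ring
    have e3 : ‖∑ t, ∑ s, ((starRingEnd ℂ) (v.ofLp s) * v.ofLp t) *
          (A.mulVec (c t) s - if s = t then 1 else 0)‖ ≤ ε := by
      refine (norm_sum_le _ _).trans ?_
      calc _ ≤ ∑ t, ∑ s, h t s * (‖v.ofLp t‖ * ‖v.ofLp s‖) := by
            refine Finset.sum_le_sum fun t _ => (norm_sum_le _ _).trans ?_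
            refine Finset.sum_le_sum fun s _ => ?_
            rw [norm_mul, norm_mul, RCLike.norm_conj, mul_comm, mul_comm ‖v.ofLp s‖]
            exact mul_le_mul_of_nonneg_right (hdual t s) (by positivity)
        _ ≤ ε * ∑ t, ‖v.ofLp t‖ ^ 2 := sum_sum_mul_le_of_row_sum_le
            (fun t s => (norm_nonneg _).trans (hdual t s)) hsymm hrow _
        _ = ε := by rw [hv2, mul_one]
    rw [e1]
    have := norm_sub_norm_le (1 : ℂ) (-(∑ t, ∑ s, ((starRingEnd ℂ) (v.ofLp s) * v.ofLp t) *
          (A.mulVec (c t) s - if s = t then 1 else 0)))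
    rw [norm_neg, norm_one, sub_neg_eq_add] at this
    linarith
  refine hlow.trans ?_
  rw [hpair]
  exact (norm_inner_le_norm _ _).trans (mul_le_mul_of_nonneg_left hfn (norm_nonneg _))

/-! ### Tensor coefficients under the Vandermonde matrix. -/

lemma vandermondeMatrix_apply {d n : ℕ} (Ω : Finset (Fin d → ℝ)) (t : Ω)
    (α : Fin d → Fin (n + 1)) :
    vandermondeMatrix Ω n t α = ∏ i, unitExp ((t : Fin d → ℝ) i) ^ (α i : ℕ) := by
  simp only [vandermondeMatrix, Matrix.of_apply, unitExp]
  refine Finset.prod_congr rfl fun i _ => ?_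
  congr 2
  push_cast
  ring

lemma sum_prod_apply_eq_prod_sum {ι κ : Type*} [Fintype ι] [DecidableEq ι] [Fintype κ]
    (f : ι → κ → ℂ) : ∑ α : ι → κ, ∏ j, f j (α j) = ∏ j, ∑ k, f j k := by
  rw [Finset.prod_univ_sum, Fintype.piFinset_univ]

open Polynomial in
lemma vandermondeMatrix_mulVec_tensor {d n : ℕ} (Ω : Finset (Fin d → ℝ)) (u : Fin d → ℂ[X])
    (hu : ∀ j, (u j).natDegree ≤ n) (s : Ω) :
    (vandermondeMatrix Ω n).mulVec (fun α => ∏ j, (u j).coeff (α j)) s =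
      ∏ j, (u j).eval (unitExp ((s : Fin d → ℝ) j)) := by
  simp only [Matrix.mulVec, dotProduct, vandermondeMatrix_apply, ← Finset.prod_mul_distrib]
  rw [sum_prod_apply_eq_prod_sum fun (j : Fin d) (k : Fin (n + 1)) =>
    unitExp ((s : Fin d → ℝ) j) ^ (k : ℕ) * (u j).coeff k]
  refine Finset.prod_congr rfl fun j _ => ?_
  rw [eval_eq_sum_range' (Nat.lt_succ_of_le (hu j)),
    ← Fin.sum_univ_eq_sum_range (fun k => (u j).coeff k * _ ^ k) (n + 1)]
  exact Finset.sum_congr rfl fun k _ => mul_comm _ _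

open Polynomial in
lemma norm_sum_conj_tensor_mul_tensor_le {d n m β : ℕ} {u u' : Fin d → ℂ[X]} {P P' : Fin d → ℝ}
    {t t' : Fin d → ℝ} (hu : ∀ j, (u j).natDegree ≤ n) (hu' : ∀ j, (u' j).natDegree ≤ n)
    (hP : ∀ j, 0 ≤ P j)
    (h : ∀ j x, ‖(u j).eval (unitExp x)‖ ≤ P j * dirichletMean m (x - t j) ^ β)
    (h' : ∀ j x, ‖(u' j).eval (unitExp x)‖ ≤ P' j * dirichletMean m (x - t' j) ^ β) :
    ‖∑ α : Fin d → Fin (n + 1), (starRingEnd ℂ) (∏ j, (u j).coeff (α j)) *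
      ∏ j, (u' j).coeff (α j)‖ ≤ (∏ j, P j) * (∏ j, P' j) *
        ∏ j, ∫ x in (0:ℝ)..1, dirichletMean m (x - t j) ^ β * dirichletMean m (x - t' j) ^ β := by
  simp only [map_prod, ← Finset.prod_mul_distrib]
  rw [sum_prod_apply_eq_prod_sum fun (j : Fin d) (k : Fin (n + 1)) =>
    (starRingEnd ℂ) ((u j).coeff k) * (u' j).coeff k, norm_prod]
  refine Finset.prod_le_prod (fun j _ => norm_nonneg _) fun j _ => ?_
  refine (norm_sum_conj_coeff_mul_coeff_le (hu j) (hu' j)).trans ?_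
  rw [← intervalIntegral.integral_const_mul]
  apply intervalIntegral.integral_mono_on zero_le_one
  · exact Continuous.intervalIntegrable (by fun_prop) _ _
  · exact Continuous.intervalIntegrable (by fun_prop) _ _
  intro x _
  have := pow_nonneg (dirichletMean_nonneg m (x - t j)) β
  calc _ ≤ (P j * dirichletMean m (x - t j) ^ β) * (P' j * dirichletMean m (x - t' j) ^ β) :=
        mul_le_mul (h j x) (h' j x) (norm_nonneg _) (mul_nonneg (hP j) this)
    _ = _ := by ring

lemma integral_dirichletMean_mul_nonneg (m k : ℕ) (a b : ℝ) :
    0 ≤ ∫ x in (0:ℝ)..1, dirichletMean m (x - a) ^ k * dirichletMean m (x - b) ^ k :=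
  intervalIntegral.integral_nonneg zero_le_one fun _ _ =>
    mul_nonneg (pow_nonneg (dirichletMean_nonneg _ _) _) (pow_nonneg (dirichletMean_nonneg _ _) _)

lemma prod_integral_dirichletMean_mul_le {d : ℕ} (m k : ℕ) (t t' : Fin d → ℝ) :
    ∏ j, ∫ x in (0:ℝ)..1, dirichletMean m (x - t j) ^ k * dirichletMean m (x - t' j) ^ k ≤
      (∫ x in (0:ℝ)..1, dirichletMean m x ^ (2 * k)) ^ d := by
  refine (Finset.prod_le_prod (fun j _ => integral_dirichletMean_mul_nonneg m k _ _)
    fun j _ => integral_dirichletMean_mul_le m k _ _).trans_eq ?_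
  simp

lemma prod_integral_dirichletMean_mul_le_of_wrapDist_pos {d m k : ℕ} (hd : 1 ≤ d) (hm : 0 < m)
    {t t' : Fin d → ℝ} (h : 0 < wrapDist t t') :
    ∏ j, ∫ x in (0:ℝ)..1, dirichletMean m (x - t j) ^ k * dirichletMean m (x - t' j) ^ k ≤
      (∫ x in (0:ℝ)..1, dirichletMean m x ^ (2 * k)) ^ (d - 1) *
        (2 * (1 / (m * wrapDist t t')) ^ k * ∫ x in (0:ℝ)..1, dirichletMean m x ^ k) := by
  obtain ⟨i, hi⟩ := exists_abs_sub_round_eq_wrapDist hd t t'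
  rw [← Finset.prod_erase_mul _ _ (Finset.mem_univ i)]
  have h1 : ∏ j ∈ Finset.univ.erase i,
      ∫ x in (0:ℝ)..1, dirichletMean m (x - t j) ^ k * dirichletMean m (x - t' j) ^ k ≤
      (∫ x in (0:ℝ)..1, dirichletMean m x ^ (2 * k)) ^ (d - 1) := by
    refine (Finset.prod_le_prod (fun j _ => integral_dirichletMean_mul_nonneg m k _ _)
      fun j _ => integral_dirichletMean_mul_le m k _ _).trans_eq ?_
    simp [Finset.card_erase_of_mem]
  refine mul_le_mul h1 (integral_dirichletMean_mul_le_of_le_abs_sub_round hm h hi.ge)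
    (integral_dirichletMean_mul_nonneg m k _ _) (pow_nonneg ?_ _)
  exact intervalIntegral.integral_nonneg zero_le_one fun _ _ => pow_nonneg (dirichletMean_nonneg _ _) _

/-! ### Cluster separation, complexity and the degree budget. -/

lemma le_wrapDist_of_le_clusterSep {d L N : ℕ} (hN : 0 < N) {Λ : Fin L → Finset (Fin d → ℝ)}
    {ρ : ℝ} (hsep : ENNReal.ofReal ρ ≤ clusterSep N Λ) {l l' : Fin L} (hl : l ≠ l')
    {a b : Fin d → ℝ} (ha : a ∈ Λ l) (hb : b ∈ Λ l') : ρ / N ≤ wrapDist a b := by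
  wlog h : l < l' generalizing l l' a b
  · rw [wrapDist_comm]
    exact this hl.symm hb ha (lt_of_le_of_ne (not_lt.1 h) hl.symm)
  have h1 : clusterSep N Λ ≤ N * ENNReal.ofReal (wrapDist a b) := by
    unfold clusterSep clusterDist
    gcongr
    refine (iInf_le _ l).trans ((iInf_le _ l').trans ((iInf_le _ h).trans ?_))
    exact (iInf₂_le a ha).trans (iInf₂_le b hb)
  have h2 := hsep.trans h1
  rw [← ENNReal.ofReal_natCast, ← ENNReal.ofReal_mul (Nat.cast_nonneg _),
    ENNReal.ofReal_le_ofReal_iff (mul_nonneg (Nat.cast_nonneg _) (wrapDist_nonneg _ _))] at h2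
  rw [div_le_iff₀' (by exact_mod_cast hN)]
  exact h2

lemma prod_le_clusterComplexity {d N : ℕ} (hN : 0 < N) {Ω S : Finset (Fin d → ℝ)}
    {t : Fin d → ℝ} (ht : t ∈ Ω) (hS : S ⊆ Ω) (hpos : ∀ t' ∈ S, 0 < wrapDist t t')
    (hle : ∀ t' ∈ S, wrapDist t t' ≤ 1 / N) :
    ∏ t' ∈ S, 1 / (N * wrapDist t t') ≤ clusterComplexity Ω N := by
  classical
  have hN' : (0 : ℝ) < N := by exact_mod_cast hN
  unfold clusterComplexity
  refine le_trans ?_ (le_ciSup (Set.finite_range _).bddAbove ⟨t, ht⟩)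
  have hsub : S ⊆ Ω.filter fun t' => 0 < wrapDist t t' ∧ wrapDist t t' ≤ 1 / (N : ℝ) :=
    fun t' ht' => Finset.mem_filter.2 ⟨hS ht', hpos t' ht', hle t' ht'⟩
  simp only
  convert_to _ ≤ ∏ t' ∈ Ω.filter fun t' => 0 < wrapDist t t' ∧ wrapDist t t' ≤ 1 / (N : ℝ),
    1 / (N * wrapDist t t')
  rw [← Finset.prod_sdiff hsub]
  refine le_mul_of_one_le_left
    (Finset.prod_nonneg fun t' ht' => (div_pos one_pos (mul_pos hN' (hpos t' ht'))).le) ?_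
  refine Finset.one_le_prod fun t' ht' => ?_
  obtain ⟨_, h1, h2⟩ := Finset.mem_filter.1 (Finset.mem_sdiff.1 ht').1
  rw [one_le_div (by positivity)]
  rwa [le_div_iff₀' hN'] at h2

lemma one_le_clusterComplexity {d N : ℕ} (hN : 0 < N) {Ω : Finset (Fin d → ℝ)}
    (hΩ : Ω.Nonempty) : 1 ≤ clusterComplexity Ω N := by
  obtain ⟨t, ht⟩ := hΩ
  simpa using prod_le_clusterComplexity hN ht (Finset.empty_subset Ω) (by simp) (by simp)

lemma card_le_maxClusterCard {d L : ℕ} (Λ : Fin L → Finset (Fin d → ℝ)) (l : Fin L) :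
    (Λ l).card ≤ maxClusterCard Λ :=
  Finset.le_sup (f := fun l => (Λ l).card) (Finset.mem_univ l)

/-- Rounding `N / lam` down loses at most a factor `2`, which the `2` in each Lagrange denominator
absorbs; every factor then costs `lam` beyond its share of the complexity. -/
lemma prod_lagrange_const_le {d N lam : ℕ} (hN : 0 < N) (hlam : 0 < lam) (hle : lam ≤ N)
    {Ω S : Finset (Fin d → ℝ)} {t : Fin d → ℝ} (ht : t ∈ Ω) (hS : S ⊆ Ω)
    (hcard : S.card ≤ lam - 1) (hpos : ∀ t' ∈ S, 0 < wrapDist t t')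
    (hclose : ∀ t' ∈ S, wrapDist t t' ≤ 1 / N) :
    ∏ t' ∈ S, 1 / (2 * (N / lam : ℕ) * wrapDist t t') ≤
      (lam : ℝ) ^ (lam - 1) * clusterComplexity Ω N := by
  have hN' : (0 : ℝ) < N := by exact_mod_cast hN
  have hlam' : (1 : ℝ) ≤ lam := by exact_mod_cast hlam
  have hM : (N : ℝ) ≤ lam * (2 * (N / lam : ℕ)) := by
    have h1 := Nat.div_add_mod N lam
    have h2 := Nat.mod_lt N hlam
    have h3 : 1 ≤ N / lam := (Nat.one_le_div_iff hlam).2 hle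
    have h4 : lam * 1 ≤ lam * (N / lam) := Nat.mul_le_mul_left _ h3
    have : N ≤ lam * (2 * (N / lam)) := by
      rw [show lam * (2 * (N / lam)) = 2 * (lam * (N / lam)) by ring]
      omega
    exact_mod_cast this
  calc ∏ t' ∈ S, 1 / (2 * (N / lam : ℕ) * wrapDist t t') ≤
      ∏ t' ∈ S, (lam * (1 / (N * wrapDist t t'))) := by
        refine Finset.prod_le_prod (fun t' ht' => div_nonneg zero_le_one
          (mul_nonneg (by positivity) (wrapDist_nonneg _ _))) fun t' ht' => ?_
        have hw := hpos t' ht'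
        have h2 : (0 : ℝ) < 2 * (N / lam : ℕ) := by
          by_contra h
          have : (lam : ℝ) * (2 * (N / lam : ℕ)) ≤ 0 :=
            mul_nonpos_of_nonneg_of_nonpos (by linarith) (not_lt.1 h)
          linarith
        rw [mul_one_div, div_le_div_iff₀ (by positivity) (by positivity)]
        nlinarith [mul_le_mul_of_nonneg_right hM hw.le]
    _ = (lam : ℝ) ^ S.card * ∏ t' ∈ S, 1 / (N * wrapDist t t') := by
        rw [Finset.prod_mul_distrib, Finset.prod_const]
    _ ≤ _ := by
        refine mul_le_mul (pow_le_pow_right₀ hlam' hcard)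
          (prod_le_clusterComplexity hN ht hS hpos hclose) ?_ (by positivity)
        exact Finset.prod_nonneg fun t' ht' => div_nonneg zero_le_one
          (mul_nonneg hN'.le (wrapDist_nonneg _ _))

/-- The Lagrange part takes at most the fraction `(lam - 1) / lam` of the degree and the kernel the
remaining `1 / lam`. After multiplication by `lam` the total is at most `(lam - 1) N + n < lam N`.
-/
lemma kernel_degree_add_le {N n lam β k : ℕ} (hN : N = n + 1) (hlam : 0 < lam)
    (hk : k ≤ lam - 1) :
    N / lam * k + β * (n / (lam * β) + 1 - 1) ≤ n := by
  rw [Nat.add_sub_cancel]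
  have h1 : N / lam * lam ≤ N := Nat.div_mul_le_self N lam
  have h2 : n / (lam * β) * (lam * β) ≤ n := Nat.div_mul_le_self n _
  have h3 : N / lam * k ≤ N / lam * (lam - 1) := Nat.mul_le_mul_left _ hk
  obtain ⟨p, rfl⟩ : ∃ p, lam = p + 1 := ⟨lam - 1, by omega⟩
  simp only [Nat.add_sub_cancel] at h3 ⊢
  generalize N / (p + 1) = a at *
  generalize n / ((p + 1) * β) = b at *
  have h4 : (p + 1) * (a * p + β * b) < (p + 1) * N := by
    calc (p + 1) * (a * p + β * b) = p * (a * (p + 1)) + b * ((p + 1) * β) := by ring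
      _ ≤ p * N + n := add_le_add (Nat.mul_le_mul_left _ h1) h2
      _ < (p + 1) * N := by rw [hN]; ring_nf; omega
  have h5 := Nat.lt_of_mul_lt_mul_left h4
  omega

/-! ### The bound for general kernel order. -/

/-- `V` dominates `1 / (m √β)`. For even `β ≥ 4` the moment constant is `1`, harmless in a `d`-th
power; `β = 2` costs `1.08`, which is why it is allowed only for `d = 1`. The constant `2.15`
exceeds `1.52 √2`, the `√2` coming from `√(β / 2)`. -/
lemma integral_kernel_pow_le {d N lam β m : ℕ} {V : ℝ} (hβ : d + 1 ≤ β) (hβe : Even β)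
    (hβ2 : β = 2 → d = 1) (hd : 1 ≤ d) (hm : 2 * β + 1 ≤ m) (hN : 0 < N)
    (hmN : N ≤ m * (lam * β)) (hV : V = √β * lam / N) :
    (∫ x in (0:ℝ)..1, dirichletMean m x ^ (2 * β)) ^ d ≤ 1.08 * V ^ d ∧
    (∫ x in (0:ℝ)..1, dirichletMean m x ^ (2 * β)) ^ (d - 1) ≤ V ^ (d - 1) ∧
    ∫ x in (0:ℝ)..1, dirichletMean m x ^ β ≤ 2.15 * V := by
  have hβ0 : 2 ≤ β := by omega
  have hβR : (0 : ℝ) < β := by exact_mod_cast (show 0 < β by omega)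
  have hmR : (0 : ℝ) < m := by exact_mod_cast (show 0 < m by omega)
  have hNR : (0 : ℝ) < N := by exact_mod_cast hN
  have hmN' : (N : ℝ) ≤ m * (lam * β) := by exact_mod_cast hmN
  have hs : 0 < √(β : ℝ) := Real.sqrt_pos.2 hβR
  have hss : √(β : ℝ) * √β = β := Real.mul_self_sqrt hβR.le
  have hmV : 1 / (m * √β) ≤ V := by
    rw [hV, div_le_div_iff₀ (by positivity) hNR]
    calc 1 * (N : ℝ) ≤ m * (lam * (√β * √β)) := by rw [hss]; linarith
      _ = _ := by ring
  have hV0 : 0 ≤ V := le_trans (by positivity) hmV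
  have hI0 : 0 ≤ ∫ x in (0:ℝ)..1, dirichletMean m x ^ (2 * β) :=
    intervalIntegral.integral_nonneg zero_le_one fun _ _ =>
      pow_nonneg (dirichletMean_nonneg _ _) _
  refine ⟨?_, ?_, ?_⟩
  · by_cases h4 : 4 ≤ β
    · have h1 := (integral_dirichletMean_pow_le_of_four_le hm h4).trans hmV
      have h2 := pow_le_pow_left₀ hI0 h1 d
      have := pow_nonneg hV0 d
      linarith
    · have hb : β = 2 := by
        obtain ⟨r, hr⟩ := hβe
        omega
      have hd1 := hβ2 hb
      subst hb
      subst hd1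
      have h1 := integral_dirichletMean_pow_four_le (m := m) (by omega)
      rw [pow_one, pow_one]
      refine h1.trans ?_
      rw [div_eq_mul_one_div]
      exact mul_le_mul_of_nonneg_left hmV (by norm_num)
  · by_cases h4 : 4 ≤ β
    · have h1 := (integral_dirichletMean_pow_le_of_four_le hm h4).trans hmV
      exact pow_le_pow_left₀ hI0 h1 _
    · have hb : β = 2 := by
        obtain ⟨r, hr⟩ := hβe
        omega
      have hd1 := hβ2 hb
      subst hd1
      simp
  · obtain ⟨r, hr⟩ := hβe
    have hr' : β = 2 * r := by omega
    have h1 := integral_dirichletMean_pow_le_crude (m := m) (g := r) (by omega) (by omega)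
    rw [← hr'] at h1
    refine h1.trans ?_
    have h2 : √(β : ℝ) = √2 * √r := by
      rw [hr']
      push_cast
      rw [Real.sqrt_mul (by norm_num)]
    have hrs : 0 < √(r : ℝ) := Real.sqrt_pos.2 (by exact_mod_cast (show 0 < r by omega))
    have h3 : √(2 : ℝ) ≤ 1.41422 := Real.sqrt_le_iff.2 ⟨by norm_num, by norm_num⟩
    have h4 : 1.52 / (m * √r) ≤ 2.15 * (1 / (m * √β)) := by
      rw [h2, mul_one_div, div_le_div_iff₀ (by positivity) (by positivity)]
      have : 0 < m * √(r : ℝ) := by positivity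
      nlinarith
    exact h4.trans (mul_le_mul_of_nonneg_left hmV (by norm_num))

/-- The lower bound for `sigmaMin` in terms of the kernel order `β` and the separation `ρ`. -/
theorem le_sigmaMin_vandermondeMatrix {d n L N lam β : ℕ} {C ρ T V : ℝ} (hd : 1 ≤ d)
    (hN : N = n + 1) {Ω : Finset (Fin d → ℝ)} (hΩ : Ω.Nonempty) {Λ : Fin L → Finset (Fin d → ℝ)}
    (hΛ : IsClusteredConfiguration N Ω Λ) (hlam : lam = maxClusterCard Λ)
    (hC : C = clusterComplexity Ω N) (hβ : d + 1 ≤ β) (hβe : Even β) (hβ2 : β = 2 → d = 1)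
    (hNβ : 2 * β ^ 2 * lam < N) (hρ : 0 < ρ) (hsep : ENNReal.ofReal ρ ≤ clusterSep N Λ)
    (hT : T = 2 ^ d * (2 ^ d - 1) * (Real.pi ^ 2 / 6) * (lam * β / ρ) ^ β)
    (hV : V = √β * lam / N) :
    (1 - lam ^ lam * C * T / 2 ^ β) /
      √(lam * (lam ^ (lam - 1) * C) ^ 2 * V ^ d * (1.08 + 4.3 * T)) ≤
        sigmaMin (vandermondeMatrix Ω n) := by
  classical
  have hN0 : 0 < N := by omega
  have hNR : (0 : ℝ) < N := by exact_mod_cast hN0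
  have hlam0 : 0 < lam := by
    obtain ⟨t, ht⟩ := hΩ
    obtain ⟨l, hl⟩ := (hΛ.mem_iff t).1 ht
    rw [hlam]
    exact (Finset.card_pos.2 ⟨t, hl⟩).trans_le (card_le_maxClusterCard Λ l)
  have hlamR : (0 : ℝ) < lam := by exact_mod_cast hlam0
  have hlamN : lam ≤ N := by nlinarith [Nat.one_le_pow 2 β (by omega)]
  have hβ0 : 0 < β := by omega
  have hβR : (0 : ℝ) < β := by exact_mod_cast hβ0
  have hC1 : 1 ≤ C := hC ▸ one_le_clusterComplexity hN0 hΩ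
  have h2d : (1 : ℝ) ≤ 2 ^ d := one_le_pow₀ (by norm_num)
  have hT0 : 0 ≤ T := by
    rw [hT]
    have : (0 : ℝ) ≤ 2 ^ d - 1 := by linarith
    positivity
  have hV0 : 0 < V := by rw [hV]; positivity
  set P : ℝ := lam ^ (lam - 1) * C with hPdef
  have hP0 : 0 < P := by positivity
  -- the kernel
  set m : ℕ := n / (lam * β) + 1 with hm
  have hm0 : 0 < m := Nat.succ_pos _
  have hmR : (0 : ℝ) < m := by exact_mod_cast hm0
  have hlb : 0 < lam * β := Nat.mul_pos hlam0 hβ0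
  have hmN : N ≤ m * (lam * β) := by
    have := Nat.lt_div_mul_add (a := n) hlb
    rw [hm, add_mul, one_mul]
    omega
  have hmβ : 2 * β + 1 ≤ m := by
    rw [hm]
    refine Nat.succ_le_succ ((Nat.le_div_iff_mul_le hlb).2 ?_)
    have : 2 * β * (lam * β) = 2 * β ^ 2 * lam := by ring
    omega
  obtain ⟨hU1, hU2, hU3⟩ := integral_kernel_pow_le hβ hβe hβ2 hd hmβ hN0 hmN hV
  set U := ∫ x in (0:ℝ)..1, dirichletMean m x ^ (2 * β) with hU
  set W := ∫ x in (0:ℝ)..1, dirichletMean m x ^ β with hW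
  have hU0 : 0 ≤ U := intervalIntegral.integral_nonneg zero_le_one fun _ _ =>
      pow_nonneg (dirichletMean_nonneg _ _) _
  have hW0 : 0 ≤ W := intervalIntegral.integral_nonneg zero_le_one fun _ _ =>
      pow_nonneg (dirichletMean_nonneg _ _) _
  -- clusters
  have hδ : 0 < ρ / N := by positivity
  choose cl hcl using fun t : Ω => (hΛ.mem_iff t).1 t.2
  have hsub : ∀ l, Λ l ⊆ Ω := fun l t ht => (hΛ.mem_iff t).2 ⟨l, ht⟩
  -- Positive separation makes the clusters disjoint, so the chosen label `cl` is the only one.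
  have hcluniq : ∀ (t : Ω) (l : Fin L), (t : Fin d → ℝ) ∈ Λ l → cl t = l := by
    intro t l hl
    by_contra hne
    have h1 := le_wrapDist_of_le_clusterSep hN0 hsep hne (hcl t) hl
    have h2 : wrapDist (t : Fin d → ℝ) t = 0 := by
      rw [wrapDist_eq_norm]
      simp [← Pi.zero_def]
    linarith
  have hfar : ∀ t s : Ω, cl s ≠ cl t → ρ / N ≤ wrapDist (t : Fin d → ℝ) s := fun t s h =>
    le_wrapDist_of_le_clusterSep hN0 hsep h.symm (hcl t) (hcl s)
  have hposΩ : ∀ t s : Ω, t ≠ s → 0 < wrapDist (t : Fin d → ℝ) s := fun t s h =>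
    wrapDist_pos (hΛ.mem_Ico t t.2) (hΛ.mem_Ico s s.2) fun h' => h (Subtype.ext h')
  -- interpolants
  have hex := fun t : Ω => exists_tensor_interpolant (m := m) (M := N / lam) (β := β) (n := n) hd
    hm0 (Nat.div_pos hlamN hlam0) t ((Λ (cl t)).erase t)
    (kernel_degree_add_le hN hlam0 (by
      rw [Finset.card_erase_of_mem (hcl t)]
      have := card_le_maxClusterCard Λ (cl t)
      omega))
    (fun t' ht' => hposΩ t ⟨t', hsub _ (Finset.mem_of_mem_erase ht')⟩
      fun h => Finset.ne_of_mem_erase ht' (congrArg Subtype.val h).symm)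
    (fun t' ht' => by
      have h1 := (hΛ.isCluster (cl t)).wrapDist_le (hcl t) (Finset.mem_of_mem_erase ht')
      -- A second node in the cluster forces `lam ≥ 2`, so `N / lam ≤ N / 2` and the magnified gap
      -- stays below `1 / 2`.
      have h2 : 2 ≤ lam := by
        have h3 := card_le_maxClusterCard Λ (cl t)
        have h4 := Finset.card_pos.2 ⟨t', ht'⟩
        rw [Finset.card_erase_of_mem (hcl t)] at h4
        omega
      have h3 : ((N / lam : ℕ) : ℝ) ≤ N / 2 := by
        refine Nat.cast_div_le.trans ?_
        have : (2 : ℝ) ≤ lam := by exact_mod_cast h2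
        gcongr
      calc ((N / lam : ℕ) : ℝ) * wrapDist t t' ≤ N / 2 * (1 / N) := by
            have := wrapDist_nonneg (t : Fin d → ℝ) t'
            gcongr
        _ = 1 / 2 := by field_simp)
  choose u Pu hdeg hPu0 hPuprod hbound hone hzero using hex
  have hPuP : ∀ t, ∏ j, Pu t j ≤ P := fun t => by
    rw [hPuprod t, hPdef, hC]
    refine prod_lagrange_const_le hN0 hlam0 hlamN t.2
      ((Finset.erase_subset _ _).trans (hsub _)) ?_ ?_ ?_
    · rw [Finset.card_erase_of_mem (hcl t)]
      have := card_le_maxClusterCard Λ (cl t)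
      omega
    · exact fun t' ht' => hposΩ t ⟨t', hsub _ (Finset.mem_of_mem_erase ht')⟩
        fun h => Finset.ne_of_mem_erase ht' (congrArg Subtype.val h).symm
    · exact fun t' ht' => (hΛ.isCluster (cl t)).wrapDist_le (hcl t) (Finset.mem_of_mem_erase ht')
  have hPuprod0 : ∀ t, 0 ≤ ∏ j, Pu t j := fun t => Finset.prod_nonneg fun j _ => hPu0 t j
  -- the decay sum over distant nodes
  have hdecay : ∀ t : Ω, ∑ s : Ω, (if cl s = cl t then 0 else
      (1 / (m * wrapDist (t : Fin d → ℝ) s)) ^ β) ≤ lam * T := by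
    intro t
    set S : Finset (Fin d → ℝ) := Ω \ Λ (cl t) with hS
    have hmemS : ∀ s : Ω, cl s = cl t ↔ (s : Fin d → ℝ) ∉ S := fun s => by
      simp only [hS, Finset.mem_sdiff, s.2, true_and, not_not]
      exact ⟨fun h => h ▸ hcl s, hcluniq s _⟩
    have e1 : ∑ s : Ω, (if cl s = cl t then 0 else
        (1 / (m * wrapDist (t : Fin d → ℝ) s)) ^ β) =
        (1 / (m : ℝ)) ^ β * ∑ s ∈ S, (1 / wrapDist (t : Fin d → ℝ) s) ^ β := by
      simp_rw [hmemS, ite_not]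
      rw [Finset.sum_coe_sort Ω (fun s => if s ∈ S then
        (1 / (m * wrapDist (t : Fin d → ℝ) s)) ^ β else 0), ← Finset.sum_filter, Finset.mul_sum]
      have : Ω.filter (· ∈ S) = S := by
        ext s
        simp only [hS, Finset.mem_filter, Finset.mem_sdiff]
        tauto
      rw [this]
      refine Finset.sum_congr rfl fun s _ => ?_
      rw [← mul_pow, one_div_mul_one_div]
    rw [e1]
    have hfarS : ∀ s ∈ S, ρ / N ≤ wrapDist (t : Fin d → ℝ) s := fun s hs => by
      have hsΩ := (Finset.mem_sdiff.1 hs).1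
      exact hfar t ⟨s, hsΩ⟩ fun h => ((hmemS ⟨s, hsΩ⟩).1 h) hs
    have h1 := sum_one_div_wrapDist_pow_le (lam := lam) hd hβ hδ t S hfarS (by
      -- Nodes pairwise closer than the separation share one cluster, so there are at most `lam` of
      -- them.
      intro A hA hclose
      rcases A.eq_empty_or_nonempty with rfl | ⟨a, ha⟩
      · simp
      have haΩ := (Finset.mem_sdiff.1 (hA ha)).1
      rw [hlam]
      refine (Finset.card_le_card fun b hb => ?_).trans (card_le_maxClusterCard Λ (cl ⟨a, haΩ⟩))
      have hbΩ := (Finset.mem_sdiff.1 (hA hb)).1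
      by_contra hne
      have := hfar ⟨a, haΩ⟩ ⟨b, hbΩ⟩ fun h => hne (h ▸ hcl ⟨b, hbΩ⟩)
      linarith [hclose a ha b hb])
    calc _ ≤ (1 / (m : ℝ)) ^ β *
          (lam * (2 ^ d * (2 ^ d - 1) * (Real.pi ^ 2 / 6) * (1 / (ρ / N)) ^ β)) := by gcongr
      _ = lam * (2 ^ d * (2 ^ d - 1) * (Real.pi ^ 2 / 6) * (1 / m * (1 / (ρ / N))) ^ β) := by
          rw [mul_pow]; ring
      _ ≤ lam * (2 ^ d * (2 ^ d - 1) * (Real.pi ^ 2 / 6) * (lam * β / ρ) ^ β) := by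
          have h2 : 1 / (m : ℝ) * (1 / (ρ / N)) ≤ lam * β / ρ := by
            have : (N : ℝ) ≤ m * (lam * β) := by exact_mod_cast hmN
            rw [one_div_mul_one_div, mul_div_assoc', one_div_div,
              div_le_div_iff₀ (by positivity) hρ]
            nlinarith
          have h3 : (0 : ℝ) ≤ 2 ^ d - 1 := by linarith
          gcongr
      _ = lam * T := by rw [hT]
  have : Nonempty Ω := hΩ.to_subtype
  refine le_sigmaMin_of_approx_dual (m := Ω) (c := fun t (α : Fin d → Fin (n + 1)) => ∏ j, (u t j).coeff (α j))
    (h := fun t s => if cl s = cl t then 0 else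
      P / 2 ^ β * (1 / (m * wrapDist (t : Fin d → ℝ) s)) ^ β)
    (g := fun t s => if cl s = cl t then P ^ 2 * U ^ d else
      P ^ 2 * U ^ (d - 1) * (2 * W) * (1 / (m * wrapDist (t : Fin d → ℝ) s)) ^ β)
    (G := lam * P ^ 2 * V ^ d * (1.08 + 4.3 * T)) _ (by positivity) ?_ ?_ ?_ ?_ ?_ ?_
  · intro s t
    simp only [eq_comm (a := cl t), wrapDist_comm (s : Fin d → ℝ)]
  · intro t
    have := mul_le_mul_of_nonneg_left (hdecay t) (show 0 ≤ P / 2 ^ β by positivity)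
    rw [Finset.mul_sum] at this
    simp only [mul_ite, mul_zero] at this
    refine this.trans_eq ?_
    have : (lam : ℝ) ^ lam = lam ^ (lam - 1) * lam := by
      rw [← pow_succ]; congr 1; omega
    rw [this, hPdef]
    ring
  · intro t s
    rw [vandermondeMatrix_mulVec_tensor Ω (u t) (hdeg t)]
    by_cases hst : s = t
    · subst hst
      simp [hone s]
    rw [if_neg hst, sub_zero]
    by_cases hc : cl s = cl t
    · rw [if_pos hc, hzero t s (Finset.mem_erase.2 ⟨fun h => hst (Subtype.ext h), hc ▸ hcl s⟩)]
      simp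
    · rw [if_neg hc, norm_prod]
      have hw := hposΩ t s (Ne.symm hst)
      obtain ⟨i, hi⟩ := exists_abs_sub_round_eq_wrapDist hd (s : Fin d → ℝ) t
      rw [wrapDist_comm] at hi
      calc _ ≤ ∏ j, (Pu t j * dirichletMean m ((s : Fin d → ℝ) j - (t : Fin d → ℝ) j) ^ β) :=
            Finset.prod_le_prod (fun j _ => norm_nonneg _) fun j _ => hbound t j _
        _ = (∏ j, Pu t j) *
            ∏ j, dirichletMean m ((s : Fin d → ℝ) j - (t : Fin d → ℝ) j) ^ β :=
            Finset.prod_mul_distrib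
        _ ≤ P * (1 / (2 * m * wrapDist (t : Fin d → ℝ) s)) ^ β := by
            refine mul_le_mul (hPuP t) ?_ (Finset.prod_nonneg fun j _ =>
              pow_nonneg (dirichletMean_nonneg _ _) _) hP0.le
            -- Only the coordinate attaining the distance supplies decay; the other kernel factors
            -- are bounded by `1`.
            rw [← Finset.prod_erase_mul _ _ (Finset.mem_univ i)]
            refine (mul_le_of_le_one_left (pow_nonneg (dirichletMean_nonneg _ _) _) ?_).trans ?_
            · exact Finset.prod_le_one (fun j _ => pow_nonneg (dirichletMean_nonneg _ _) _)
                fun j _ => pow_le_one₀ (dirichletMean_nonneg _ _) (dirichletMean_le_one _ _)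
            · exact pow_le_pow_left₀ (dirichletMean_nonneg _ _)
                (dirichletMean_le_of_le_abs_sub_round hm0 hw hi.ge) _
        _ = _ := by
            rw [mul_assoc 2, ← one_div_mul_one_div, mul_pow, one_div_pow]
            ring
  · intro s t
    simp only [eq_comm (a := cl t), wrapDist_comm (s : Fin d → ℝ)]
  · intro t
    have e1 : ∀ s : Ω, (if cl s = cl t then P ^ 2 * U ^ d else
        P ^ 2 * U ^ (d - 1) * (2 * W) * (1 / (m * wrapDist (t : Fin d → ℝ) s)) ^ β) =
        (if cl s = cl t then P ^ 2 * U ^ d else 0) + P ^ 2 * U ^ (d - 1) * (2 * W) *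
          (if cl s = cl t then 0 else (1 / (m * wrapDist (t : Fin d → ℝ) s)) ^ β) := fun s => by
      split_ifs <;> ring
    simp_rw [e1]
    rw [Finset.sum_add_distrib, ← Finset.mul_sum, ← Finset.sum_filter, Finset.sum_const,
      nsmul_eq_mul]
    have hcard : (Finset.univ.filter fun s : Ω => cl s = cl t).card ≤ lam := by
      rw [hlam]
      refine le_trans ?_ (card_le_maxClusterCard Λ (cl t))
      refine Finset.card_le_card_of_injOn Subtype.val (fun s hs => ?_)
        Subtype.val_injective.injOn
      have : cl s = cl t := by simpa using hs
      exact this ▸ hcl s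
    have hcard' : ((Finset.univ.filter fun s : Ω => cl s = cl t).card : ℝ) ≤ lam := by
      exact_mod_cast hcard
    have hd' : V ^ d = V ^ (d - 1) * V := by
      rw [← pow_succ]; congr 1; omega
    -- The row has at most `lam` diagonal-type entries, and `4.3 = 2 * 2.15` arises from the
    -- correlation bound between clusters.
    calc _ ≤ (lam : ℝ) * (P ^ 2 * (1.08 * V ^ d)) +
          P ^ 2 * V ^ (d - 1) * (2 * (2.15 * V)) * (lam * T) := by
          have hsum0 : 0 ≤ ∑ s : Ω, (if cl s = cl t then 0 else
              (1 / (m * wrapDist (t : Fin d → ℝ) s)) ^ β) := Finset.sum_nonneg fun s _ => by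
            split_ifs
            · exact le_rfl
            · exact pow_nonneg (div_nonneg zero_le_one
                (mul_nonneg hmR.le (wrapDist_nonneg _ _))) _
          refine add_le_add ?_ (mul_le_mul ?_ (hdecay t) hsum0 (by positivity))
          · gcongr
          · gcongr
      _ = _ := by rw [hd']; ring
  · intro t s
    refine (norm_sum_conj_tensor_mul_tensor_le (hdeg t) (hdeg s) (hPu0 t)
      (hbound t) (hbound s)).trans ?_
    have hPP : (∏ j, Pu t j) * ∏ j, Pu s j ≤ P ^ 2 := by
      rw [pow_two]
      exact mul_le_mul (hPuP t) (hPuP s) (hPuprod0 s) hP0.le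
    have hI := Finset.prod_nonneg fun (j : Fin d) (_ : j ∈ Finset.univ) =>
      integral_dirichletMean_mul_nonneg m β ((t : Fin d → ℝ) j) ((s : Fin d → ℝ) j)
    by_cases hc : cl s = cl t
    · rw [if_pos hc]
      exact mul_le_mul hPP (prod_integral_dirichletMean_mul_le m β _ _) hI (by positivity)
    · rw [if_neg hc]
      have hw := hposΩ t s fun h => hc (by rw [h])
      refine (mul_le_mul hPP (prod_integral_dirichletMean_mul_le_of_wrapDist_pos hd hm0 hw) hI
        (by positivity)).trans_eq ?_
      ring

/-! ### Numerical constants. -/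

lemma sqrt_gram_bound_eq {d N lam β : ℕ} {C V Y : ℝ} (hN : 0 < N) (hlam : 0 < lam)
    (hC : 0 ≤ C) (hY : 0 ≤ Y) (hV : V = √β * lam / N) :
    √(lam * (lam ^ (lam - 1) * C) ^ 2 * V ^ d * Y) =
      √Y * (β : ℝ) ^ ((d : ℝ) / 4) * (lam : ℝ) ^ ((lam : ℝ) + (d : ℝ) / 2 - 1 / 2) * C /
        (N : ℝ) ^ ((d : ℝ) / 2) := by
  have hNR : (0 : ℝ) < N := by exact_mod_cast hN
  have hlamR : (0 : ℝ) < lam := by exact_mod_cast hlam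
  have hβR : (0 : ℝ) ≤ β := Nat.cast_nonneg _
  rw [Real.sqrt_eq_iff_mul_self_eq (by rw [hV]; positivity) (by positivity)]
  have e1 : ((β : ℝ) ^ ((d : ℝ) / 4)) ^ 2 = √β ^ d := by
    rw [← Real.rpow_natCast, ← Real.rpow_mul hβR, Real.sqrt_eq_rpow, ← Real.rpow_natCast,
      ← Real.rpow_mul hβR]
    congr 1
    push_cast
    ring
  have e2 : ((N : ℝ) ^ ((d : ℝ) / 2)) ^ 2 = (N : ℝ) ^ d := by
    rw [← Real.rpow_natCast, ← Real.rpow_mul hNR.le, ← Real.rpow_natCast]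
    congr 1
    push_cast
    ring
  have e3 : ((lam : ℝ) ^ ((lam : ℝ) + (d : ℝ) / 2 - 1 / 2)) ^ 2 =
      lam * (lam ^ (lam - 1)) ^ 2 * (lam : ℝ) ^ d := by
    have e4 : (lam : ℝ) * (lam ^ (lam - 1)) ^ 2 * (lam : ℝ) ^ d =
        (lam : ℝ) ^ (2 * (lam - 1) + 1 + d) := by ring
    rw [e4, ← Real.rpow_natCast, ← Real.rpow_mul hlamR.le, ← Real.rpow_natCast]
    congr 1
    rw [Nat.cast_add, Nat.cast_add, Nat.cast_mul, Nat.cast_sub hlam]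
    push_cast
    ring
  have e5 : √Y ^ 2 = Y := Real.sq_sqrt hY
  rw [← pow_two, div_pow, mul_pow _ C, mul_pow _ C, mul_pow, mul_pow √Y, e1, e2, e3, e5, hV, div_pow, mul_pow]
  ring

/-- After cancelling the common powers of `N`, `lam` and `C`, only the comparison `hle` of constants
remains; `K` and `D` are the constant and base in the desired bound. -/
lemma target_le_of_le {d N lam β : ℕ} {C V Y ε K D σ : ℝ} (hN : 0 < N) (hlam : 0 < lam)
    (hβ : 0 < β) (hC : 0 < C) (hY : 0 < Y) (hK : 0 < K) (hD : 0 < D) (hV : V = √β * lam / N)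
    (hle : √Y * (β : ℝ) ^ ((d : ℝ) / 4) ≤ (1 - ε) * (K * D ^ ((d : ℝ) / 4)))
    (hσ : (1 - ε) / √(lam * (lam ^ (lam - 1) * C) ^ 2 * V ^ d * Y) ≤ σ) :
    (K * D ^ ((d : ℝ) / 4) * (lam : ℝ) ^ ((lam : ℝ) + (d : ℝ) / 2 - 1 / 2))⁻¹
          * ((N : ℝ) ^ ((d : ℝ) / 2) / C) ≤ σ := by
  have hNR : (0 : ℝ) < N := by exact_mod_cast hN
  have hlamR : (0 : ℝ) < lam := by exact_mod_cast hlam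
  have hβR : (0 : ℝ) < β := by exact_mod_cast hβ
  refine le_trans ?_ hσ
  rw [sqrt_gram_bound_eq hN hlam hC.le hY.le hV]
  have hYs : 0 < √Y := Real.sqrt_pos.2 hY
  have hE : 0 < (lam : ℝ) ^ ((lam : ℝ) + (d : ℝ) / 2 - 1 / 2) := Real.rpow_pos_of_pos hlamR _
  generalize (lam : ℝ) ^ ((lam : ℝ) + (d : ℝ) / 2 - 1 / 2) = E at *
  have hB : 0 < (β : ℝ) ^ ((d : ℝ) / 4) := Real.rpow_pos_of_pos hβR _
  generalize (β : ℝ) ^ ((d : ℝ) / 4) = B at *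
  have hM : 0 < (N : ℝ) ^ ((d : ℝ) / 2) := Real.rpow_pos_of_pos hNR _
  generalize (N : ℝ) ^ ((d : ℝ) / 2) = M at *
  have hD' : 0 < D ^ ((d : ℝ) / 4) := Real.rpow_pos_of_pos hD _
  generalize D ^ ((d : ℝ) / 4) = G at *
  rw [inv_mul_eq_div, div_div, div_div_eq_mul_div, div_le_div_iff₀ (by positivity) (by positivity)]
  have : 0 < M * (E * C) := by positivity
  nlinarith [mul_le_mul_of_nonneg_left hle this.le]

lemma pi_sq_div_six_lt : Real.pi ^ 2 / 6 < 1.645 := by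
  have := Real.pi_lt_d6
  have := Real.pi_gt_three
  nlinarith

/-- The geometric sum constant for the polynomial decay of order `β`. -/
lemma decay_constant_le {d β : ℕ} (hd : 1 ≤ d) (hβ : β = if Odd d then d + 1 else d + 2) :
    (2 : ℝ) ^ d * (2 ^ d - 1) * (Real.pi ^ 2 / 6) * (β / (6 * d)) ^ β ≤ 0.37 := by
  have hpi := pi_sq_div_six_lt
  have hpi0 : 0 < Real.pi ^ 2 / 6 := by positivity
  have h2d : (1 : ℝ) ≤ 2 ^ d := one_le_pow₀ (by norm_num)
  have hdR : (1 : ℝ) ≤ d := by exact_mod_cast hd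
  have h4 : (2 : ℝ) ^ d * (2 ^ d - 1) ≤ 4 ^ d := by
    rw [show (4 : ℝ) = 2 * 2 by norm_num, mul_pow]
    nlinarith
  have key : ∀ q : ℝ, β / (6 * d) ≤ q → (4 : ℝ) ^ d * 1.645 * q ^ β ≤ 0.37 →
      (2 : ℝ) ^ d * (2 ^ d - 1) * (Real.pi ^ 2 / 6) * (β / (6 * d)) ^ β ≤ 0.37 := by
    intro q hq h
    refine le_trans ?_ h
    have h0 : (0 : ℝ) ≤ 2 ^ d - 1 := by linarith
    gcongr
  by_cases ho : Odd d
  · rw [if_pos ho] at hβ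
    -- For `d = 1` the estimate by `4 ^ d` would be too lossy, so the exact factor `2 ^ d * (2 ^ d -
    -- 1) = 2` is kept.
    by_cases h1 : d = 1
    · subst h1
      norm_num at hβ
      subst hβ
      norm_num
      linarith
    · have h3 : 3 ≤ d := by obtain ⟨r, hr⟩ := ho; omega
      have h3R : (3 : ℝ) ≤ d := by exact_mod_cast h3
      apply key (2 / 9)
      · rw [hβ, div_le_div_iff₀ (by positivity) (by norm_num)]
        push_cast
        linarith
      · rw [hβ, pow_succ]
        have : (8 / 9 : ℝ) ^ d ≤ 1 := pow_le_one₀ (by norm_num) (by norm_num)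
        calc (4 : ℝ) ^ d * 1.645 * ((2 / 9) ^ d * (2 / 9)) =
            (4 * (2 / 9)) ^ d * (1.645 * (2 / 9)) := by rw [mul_pow]; ring
          _ ≤ 1 * (1.645 * (2 / 9)) := by norm_num at this ⊢; linarith
          _ ≤ _ := by norm_num
  · rw [if_neg ho] at hβ
    by_cases h1 : d = 2
    · subst h1
      norm_num at hβ
      subst hβ
      apply key (1 / 3)
      · norm_num
      · norm_num
    · have h3 : 4 ≤ d := by
        rw [Nat.not_odd_iff_even] at ho
        obtain ⟨r, hr⟩ := ho; omega
      have h3R : (4 : ℝ) ≤ d := by exact_mod_cast h3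
      apply key (1 / 4)
      · rw [hβ, div_le_div_iff₀ (by positivity) (by norm_num)]
        push_cast
        linarith
      · rw [hβ, pow_add]
        calc (4 : ℝ) ^ d * 1.645 * ((1 / 4) ^ d * (1 / 4) ^ 2) =
            (4 * (1 / 4)) ^ d * (1.645 * (1 / 4) ^ 2) := by rw [mul_pow]; ring
          _ ≤ _ := by norm_num

/-- Since `1 + 2 / d ≤ exp (2 / d)`, the ratio is at most `exp (1 / 2) < 1.65`. -/
lemma rpow_div_four_le {d β : ℕ} (hd : 1 ≤ d) (hβ : β ≤ d + 2) :
    (β : ℝ) ^ ((d : ℝ) / 4) ≤ 1.65 * (d : ℝ) ^ ((d : ℝ) / 4) := by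
  have hdR : (0 : ℝ) < d := by exact_mod_cast hd
  have hβR : (β : ℝ) ≤ d + 2 := by exact_mod_cast hβ
  have h1 : (β : ℝ) ≤ Real.exp (2 / d) * d := by
    have := mul_le_mul_of_nonneg_right (Real.add_one_le_exp (2 / (d : ℝ))) hdR.le
    have e : (2 / (d : ℝ) + 1) * d = d + 2 := by field_simp; ring
    linarith
  calc (β : ℝ) ^ ((d : ℝ) / 4) ≤ (Real.exp (2 / d) * d) ^ ((d : ℝ) / 4) :=
        Real.rpow_le_rpow (Nat.cast_nonneg _) h1 (by positivity)
    _ = Real.exp (1 / 2) * (d : ℝ) ^ ((d : ℝ) / 4) := by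
        rw [Real.mul_rpow (Real.exp_pos _).le hdR.le, ← Real.exp_mul]
        congr 2
        field_simp
        norm_num
    _ ≤ _ := by
        refine mul_le_mul_of_nonneg_right ?_ (by positivity)
        have h2 : Real.exp (1 / 2) ^ 2 ≤ 1.65 ^ 2 := by
          rw [← Real.exp_nat_mul]
          norm_num
          have := Real.exp_one_lt_d9
          linarith
        exact le_of_sq_le_sq h2 (by norm_num)

/-- Here `1.4` covers `2 log 2`, and `2.5` is the rounding loss `2` of an even ceiling plus `0.5 ≥
log ζ(2)`. -/
lemma two_add_log_le {d : ℕ} (hd : 1 ≤ d) {X : ℝ} (hX : 1 ≤ X) :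
    Real.log (2 ^ d * (2 ^ d - 1) * X * (Real.pi ^ 2 / 6)) + 2 ≤
      2.5 + 1.4 * d + Real.log X := by
  have h2 : (2 : ℝ) ≤ 2 ^ d := by
    simpa using pow_le_pow_right₀ (show (1 : ℝ) ≤ 2 by norm_num) hd
  have hp : (0 : ℝ) < 2 ^ d - 1 := by linarith
  have hdR : (1 : ℝ) ≤ d := by exact_mod_cast hd
  rw [Real.log_mul (by positivity) (by positivity), Real.log_mul (by positivity) (by positivity),
    Real.log_mul (by positivity) (by positivity), Real.log_pow]
  have h3 : Real.log (2 ^ d - 1) ≤ d * Real.log 2 := by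
    rw [← Real.log_pow]
    exact Real.log_le_log hp (by linarith)
  have h4 := Real.log_two_lt_d9
  have h5 : Real.log (Real.pi ^ 2 / 6) ≤ 0.5 := by
    rw [Real.log_le_iff_le_exp (by positivity)]
    have h6 : (1.645 : ℝ) ^ 2 ≤ Real.exp 0.5 ^ 2 := by
      rw [← Real.exp_nat_mul]
      norm_num
      have := Real.exp_one_gt_d9
      linarith
    exact pi_sq_div_six_lt.le.trans (le_of_sq_le_sq h6 (Real.exp_pos _).le)
  nlinarith

lemma exp_mul_pow_le {β : ℕ} {l B : ℝ} (hβ : 2 ≤ β) (hβe : Even β) (hl : l ≤ β) (hl2 : β < l + 2)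
    (hB : l + 2 ≤ B) : Real.exp l * (β / (3.3 * B)) ^ β ≤ 0.17 := by
  have hβR : (2 : ℝ) ≤ β := by exact_mod_cast hβ
  have hβ0 : (0 : ℝ) < β := by linarith
  set s := (β : ℝ) - l with hs
  have hs0 : 0 ≤ s := by linarith
  have hs2 : s < 2 := by linarith
  have hB0 : 0 < B := by linarith
  -- This reduces to the extreme case `s = 0`: `β (β + 2) ≤ (β + s) (β + 2 - s)` because `s (2 - s)
  -- ≥ 0`.
  have h1 : Real.exp (-(s / β)) * (β + 2) ≤ B := by
    have h2 : Real.exp (-(s / β)) ≤ β / (β + s) := by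
      rw [Real.exp_neg]
      apply inv_le_of_inv_le₀ (by positivity)
      rw [inv_div]
      have := Real.add_one_le_exp (s / β)
      have e : (β + s) / β = s / β + 1 := by field_simp; ring
      linarith
    calc _ ≤ β / (β + s) * (β + 2) := by gcongr
      _ ≤ l + 2 := by
        rw [div_mul_eq_mul_div, div_le_iff₀ (by positivity)]
        have : l = β - s := by linarith
        rw [this]
        nlinarith [mul_nonneg hs0 (sub_nonneg.2 hs2.le)]
      _ ≤ B := hB
  have h3 : Real.exp (-(s / β)) * (β / (3.3 * B)) ≤ β / (3.3 * (β + 2)) := by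
    rw [mul_div_assoc', div_le_div_iff₀ (by positivity) (by positivity)]
    nlinarith
  have h4 : Real.exp l = Real.exp 1 ^ β * Real.exp (-(s / β)) ^ β := by
    rw [← Real.exp_nat_mul, ← Real.exp_nat_mul, ← Real.exp_add]
    congr 1
    rw [hs]
    field_simp
    ring
  -- Bernoulli gives `(1 + 1 / r) ^ r ≥ 2` for `r = β / 2`, and the power `β` is its square.
  have h5 : (4 : ℝ) ≤ (((β : ℝ) + 2) / β) ^ β := by
    obtain ⟨r, hr⟩ := hβe
    have hr0 : (0 : ℝ) < r := by exact_mod_cast (show 0 < r by omega)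
    have hβr : (β : ℝ) = 2 * r := by rw [hr]; push_cast; ring
    have hb := one_add_mul_le_pow (show (-2 : ℝ) ≤ 1 / r by
      have : 0 < 1 / (r : ℝ) := by positivity
      linarith) r
    rw [mul_one_div_cancel hr0.ne'] at hb
    have e : ((β : ℝ) + 2) / β = 1 + 1 / r := by
      rw [hβr]
      field_simp
    rw [e, hr, pow_add]
    nlinarith
  have h6 : (Real.exp 1 / 3.3) ^ β ≤ 0.68 := by
    have h7 : Real.exp 1 / 3.3 ≤ 0.824 := by
      have := Real.exp_one_lt_d9
      rw [div_le_iff₀ (by norm_num)]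
      linarith
    calc (Real.exp 1 / 3.3) ^ β ≤ 0.824 ^ β := by gcongr
      _ ≤ 0.824 ^ 2 := pow_le_pow_of_le_one (by norm_num) (by norm_num) hβ
      _ ≤ _ := by norm_num
  calc Real.exp l * (β / (3.3 * B)) ^ β =
      Real.exp 1 ^ β * (Real.exp (-(s / β)) * (β / (3.3 * B))) ^ β := by
        rw [h4, mul_pow, mul_assoc]
    _ ≤ Real.exp 1 ^ β * (β / (3.3 * (β + 2))) ^ β := by gcongr
    _ = (Real.exp 1 / 3.3) ^ β * ((((β : ℝ) + 2) / β) ^ β)⁻¹ := by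
        rw [← mul_pow, ← inv_pow, ← mul_pow]
        congr 1
        field_simp
    _ ≤ 0.68 * 4⁻¹ := by gcongr
    _ = 0.17 := by norm_num

/-! ### The two separation regimes. -/

/-- The lower bound under polynomial dependence of the separation on the complexity. -/
lemma le_sigmaMin_of_polynomial_separation {d n L : ℕ} (hd : 1 ≤ d)
    (Ω : Finset (Fin d → ℝ)) (hΩ : Ω.Nonempty) (Λ : Fin L → Finset (Fin d → ℝ))
    (N lam : ℕ) (C : ℝ) (hN : N = n + 1)
    (hΛ : IsClusteredConfiguration N Ω Λ)
    (hlam : lam = maxClusterCard Λ) (hC : C = clusterComplexity Ω N) :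
    ∀ β : ℕ, β = (if Odd d then d + 1 else d + 2) →
      2 * β ^ 2 * lam < N →
      ENNReal.ofReal (6 * d * lam * ((lam : ℝ) ^ lam * C) ^ (1 / ((d : ℝ) + 1)))
        ≤ clusterSep N Λ →
      (3 * (d : ℝ) ^ ((d : ℝ) / 4) * (lam : ℝ) ^ ((lam : ℝ) + (d : ℝ) / 2 - 1 / 2))⁻¹
          * ((N : ℝ) ^ ((d : ℝ) / 2) / C)
        ≤ sigmaMin (vandermondeMatrix Ω n) := by
  have hN0 : 0 < N := by omega
  have hC1 : 1 ≤ C := hC ▸ one_le_clusterComplexity hN0 hΩ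
  have hC0 : 0 < C := by linarith
  have hlam0 : 0 < lam := by
    obtain ⟨t, ht⟩ := hΩ
    obtain ⟨l, hl⟩ := (hΛ.mem_iff t).1 ht
    rw [hlam]
    exact (Finset.card_pos.2 ⟨t, hl⟩).trans_le (card_le_maxClusterCard Λ l)
  have hlamR : (1 : ℝ) ≤ lam := by exact_mod_cast hlam0
  have hlamR0 : (0 : ℝ) < lam := by linarith
  have hdR : (1 : ℝ) ≤ d := by exact_mod_cast hd
  have h2d : (2 : ℝ) ≤ 2 ^ d := by
    simpa using pow_le_pow_right₀ (show (1 : ℝ) ≤ 2 by norm_num) hd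
  have h2d' : (1 : ℝ) ≤ 2 ^ d - 1 := by linarith
  set X : ℝ := (lam : ℝ) ^ lam * C with hX
  have hX1 : 1 ≤ X := one_le_mul_of_one_le_of_one_le (one_le_pow₀ hlamR) hC1
  have hX0 : 0 < X := by linarith
  intro β hβ hNβ hsep
  have hβd : d + 1 ≤ β := by rw [hβ]; split_ifs <;> omega
  have hβd2 : β ≤ d + 2 := by rw [hβ]; split_ifs <;> omega
  have hβe : Even β := by
    rw [hβ]
    split_ifs with ho
    · exact ho.add_one
    · exact (Nat.not_odd_iff_even.1 ho).add even_two
  have hβ0 : 0 < β := by omega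
  set Y := X ^ (1 / ((d : ℝ) + 1)) with hY
  have hY1 : 1 ≤ Y := Real.one_le_rpow hX1 (by positivity)
  -- The separation carries the factor `Y`, so the decay of order `β` gains `Y ^ β`, which cancels
  -- the complexity `X`.
  have hXY : X ≤ Y ^ β := by
    have e : Y ^ (d + 1) = X := by
      rw [hY, ← Real.rpow_natCast, ← Real.rpow_mul hX0.le]
      push_cast
      rw [one_div_mul_cancel (by positivity), Real.rpow_one]
    rw [← e]
    exact pow_le_pow_right₀ hY1 hβd
  have hρ : 0 < 6 * d * lam * Y := by positivity
  have hcore := le_sigmaMin_vandermondeMatrix hd hN hΩ hΛ hlam hC hβd hβe (fun h => by omega)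
    hNβ hρ hsep rfl rfl
  set T : ℝ := 2 ^ d * (2 ^ d - 1) * (Real.pi ^ 2 / 6) * (lam * β / (6 * d * lam * Y)) ^ β
    with hT
  have hT0 : 0 ≤ T := by positivity
  have hXT : X * T ≤ 0.37 := by
    refine le_trans ?_ (decay_constant_le hd hβ)
    have e : lam * (β : ℝ) / (6 * d * lam * Y) = β / (6 * d) / Y := by field_simp
    rw [hT, e, div_pow _ Y, mul_div_assoc', mul_div_assoc', div_le_iff₀ (by positivity),
      mul_comm X]
    exact mul_le_mul_of_nonneg_left hXY (by positivity)
  have hTle : T ≤ 0.37 := (le_mul_of_one_le_left hT0 hX1).trans hXT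
  -- `0.0925 = 0.37 / 4`, since `β ≥ 2`.
  have hε : X * T / 2 ^ β ≤ 0.0925 := by
    rw [div_le_iff₀ (by positivity)]
    have : (2 : ℝ) ^ 2 ≤ 2 ^ β := pow_le_pow_right₀ (by norm_num) (by omega)
    linarith
  refine target_le_of_le hN0 hlam0 hβ0 hC0 (by positivity) (by norm_num) (by linarith) rfl
    ?_ hcore
  have h1 : √(1.08 + 4.3 * T) ≤ 1.635 := Real.sqrt_le_iff.2 ⟨by norm_num, by linarith⟩
  have h2 := rpow_div_four_le hd hβd2
  have h3 : 0 < (d : ℝ) ^ ((d : ℝ) / 4) := Real.rpow_pos_of_pos (by linarith) _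
  calc _ ≤ 1.635 * (1.65 * (d : ℝ) ^ ((d : ℝ) / 4)) :=
        mul_le_mul h1 h2 (by positivity) (by norm_num)
    _ ≤ (1 - 0.0925) * (3 * (d : ℝ) ^ ((d : ℝ) / 4)) := by linarith
    _ ≤ _ := by gcongr

/-- The lower bound under logarithmic dependence of the separation on the complexity. -/
lemma le_sigmaMin_of_logarithmic_separation {d n L : ℕ} (hd : 1 ≤ d)
    (Ω : Finset (Fin d → ℝ)) (hΩ : Ω.Nonempty) (Λ : Fin L → Finset (Fin d → ℝ))
    (N lam : ℕ) (C : ℝ) (hN : N = n + 1)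
    (hΛ : IsClusteredConfiguration N Ω Λ)
    (hlam : lam = maxClusterCard Λ) (hC : C = clusterComplexity Ω N) :
    ∀ β : ℕ, β = 2 * ⌈(1 / 2 : ℝ) * Real.log
          (2 ^ d * (2 ^ d - 1) * (lam : ℝ) ^ lam * (riemannZeta 2).re * C)⌉₊ →
      2 * β ^ 2 * lam < N →
      ENNReal.ofReal (3.3 * lam * (2.5 + 1.4 * d + lam * Real.log lam + Real.log C))
        ≤ clusterSep N Λ →
      (1.5 * (2.5 + 1.4 * (d : ℝ) + lam * Real.log lam + Real.log C) ^ ((d : ℝ) / 4)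
            * (lam : ℝ) ^ ((lam : ℝ) + (d : ℝ) / 2 - 1 / 2))⁻¹
          * ((N : ℝ) ^ ((d : ℝ) / 2) / C)
        ≤ sigmaMin (vandermondeMatrix Ω n) := by
  have hN0 : 0 < N := by omega
  have hC1 : 1 ≤ C := hC ▸ one_le_clusterComplexity hN0 hΩ
  have hC0 : 0 < C := by linarith
  have hlam0 : 0 < lam := by
    obtain ⟨t, ht⟩ := hΩ
    obtain ⟨l, hl⟩ := (hΛ.mem_iff t).1 ht
    rw [hlam]
    exact (Finset.card_pos.2 ⟨t, hl⟩).trans_le (card_le_maxClusterCard Λ l)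
  have hlamR : (1 : ℝ) ≤ lam := by exact_mod_cast hlam0
  have hlamR0 : (0 : ℝ) < lam := by linarith
  have hdR : (1 : ℝ) ≤ d := by exact_mod_cast hd
  have h2d : (2 : ℝ) ≤ 2 ^ d := by
    simpa using pow_le_pow_right₀ (show (1 : ℝ) ≤ 2 by norm_num) hd
  have h2d' : (1 : ℝ) ≤ 2 ^ d - 1 := by linarith
  have hpi' : (1.5 : ℝ) ≤ Real.pi ^ 2 / 6 := by nlinarith [Real.pi_gt_three]
  set X : ℝ := (lam : ℝ) ^ lam * C with hX
  have hX1 : 1 ≤ X := one_le_mul_of_one_le_of_one_le (one_le_pow₀ hlamR) hC1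
  have hX0 : 0 < X := by linarith
  intro β hβ hNβ hsep
  have hz : (riemannZeta 2).re = Real.pi ^ 2 / 6 := by
    rw [riemannZeta_two]
    rw [show (Real.pi : ℂ) ^ 2 / 6 = ((Real.pi ^ 2 / 6 : ℝ) : ℂ) by push_cast; rfl,
      Complex.ofReal_re]
  have hQ : (2 : ℝ) ^ d * (2 ^ d - 1) * (lam : ℝ) ^ lam * (riemannZeta 2).re * C =
      2 ^ d * (2 ^ d - 1) * X * (Real.pi ^ 2 / 6) := by
    rw [hz, hX]; ring
  have hlogX : Real.log X = lam * Real.log lam + Real.log C := by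
    rw [hX, Real.log_mul (by positivity) (by positivity), Real.log_pow]
  have hBX : 2.5 + 1.4 * (d : ℝ) + lam * Real.log lam + Real.log C =
      2.5 + 1.4 * d + Real.log X := by rw [hlogX]; ring
  rw [hQ] at hβ
  rw [hBX] at hsep ⊢
  set B := 2.5 + 1.4 * (d : ℝ) + Real.log X with hB
  set l := Real.log (2 ^ d * (2 ^ d - 1) * X * (Real.pi ^ 2 / 6)) with hl
  have hlB : l + 2 ≤ B := two_add_log_le hd hX1
  have hexp : Real.exp l = 2 ^ d * (2 ^ d - 1) * X * (Real.pi ^ 2 / 6) :=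
    Real.exp_log (by positivity)
  -- With `e < 3` this yields `l > d`, so the logarithmic `β` automatically meets the requirement `d
  -- + 1 ≤ β` of the core estimate.
  have h3d : (3 : ℝ) ^ d ≤ Real.exp l := by
    obtain ⟨k, rfl⟩ : ∃ k, d = k + 1 := ⟨d - 1, by omega⟩
    have h4 : (4 : ℝ) ^ (k + 1) = 2 ^ (k + 1) * 2 ^ (k + 1) := by rw [← mul_pow]; norm_num
    have h5 : (3 : ℝ) ^ k ≤ 4 ^ k := pow_le_pow_left₀ (by norm_num) (by norm_num) k
    have h6 : (4 : ℝ) ^ (k + 1) / 2 ≤ 2 ^ (k + 1) * (2 ^ (k + 1) - 1) := by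
      rw [h4]; nlinarith
    calc (3 : ℝ) ^ (k + 1) ≤ 4 ^ (k + 1) / 2 * 1 * 1.5 := by
          rw [pow_succ, pow_succ]; linarith
      _ ≤ Real.exp l := by rw [hexp]; gcongr
  have hdl : (d : ℝ) < l := by
    rw [← Real.exp_lt_exp]
    refine lt_of_lt_of_le ?_ h3d
    rw [← mul_one (d : ℝ), Real.exp_nat_mul]
    exact pow_lt_pow_left₀ (by linarith [Real.exp_one_lt_d9]) (Real.exp_pos _).le (by omega)
  have hl0 : 0 ≤ l := by linarith
  have hlβ : l ≤ β := by
    have := Nat.le_ceil (1 / 2 * l)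
    rw [hβ]
    push_cast
    linarith
  -- Rounding up to an even integer costs less than `2`; positivity of `l` is what makes the
  -- natural-number ceiling the true one.
  have hβl : (β : ℝ) < l + 2 := by
    have := Nat.ceil_lt_add_one (show 0 ≤ 1 / 2 * l by linarith)
    rw [hβ]
    push_cast
    linarith
  have hβe : Even β := hβ ▸ even_two_mul _
  have hβd : d + 1 ≤ β := by
    have : (d : ℝ) < β := hdl.trans_le hlβ
    exact_mod_cast this
  have hβ2 : β = 2 → d = 1 := by omega
  have hβ0 : 0 < β := by omega
  have hβR : (0 : ℝ) < β := by exact_mod_cast hβ0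
  have hβB : (β : ℝ) ≤ B := by linarith
  have hB0 : 0 < B := by linarith
  have hρ : 0 < 3.3 * lam * B := by positivity
  have hcore := le_sigmaMin_vandermondeMatrix hd hN hΩ hΛ hlam hC hβd hβe hβ2
    hNβ hρ hsep rfl rfl
  set T : ℝ := 2 ^ d * (2 ^ d - 1) * (Real.pi ^ 2 / 6) * (lam * β / (3.3 * lam * B)) ^ β
    with hT
  have hT0 : 0 ≤ T := by positivity
  have hXT : X * T ≤ 0.17 := by
    refine le_trans (le_of_eq ?_) (exp_mul_pow_le (by omega) hβe hlβ hβl hlB)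
    have e : lam * (β : ℝ) / (3.3 * lam * B) = β / (3.3 * B) := by field_simp
    rw [hT, hexp, e]
    ring
  have hTle : T ≤ 0.17 := (le_mul_of_one_le_left hT0 hX1).trans hXT
  have hε : X * T / 2 ^ β ≤ 0.0425 := by
    rw [div_le_iff₀ (by positivity)]
    have : (2 : ℝ) ^ 2 ≤ 2 ^ β := pow_le_pow_right₀ (by norm_num) (by omega)
    linarith
  refine target_le_of_le hN0 hlam0 hβ0 hC0 (by positivity) (by norm_num) hB0 rfl ?_ hcore
  -- `1.08 + 4.3 * 0.17 = 1.811`, and `1.35` still fits under `(1 - 0.0425) * 1.5`.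
  have h1 : √(1.08 + 4.3 * T) ≤ 1.35 := Real.sqrt_le_iff.2 ⟨by norm_num, by linarith⟩
  have h2 : (β : ℝ) ^ ((d : ℝ) / 4) ≤ B ^ ((d : ℝ) / 4) :=
    Real.rpow_le_rpow hβR.le hβB (by positivity)
  have h3 : 0 < B ^ ((d : ℝ) / 4) := Real.rpow_pos_of_pos hB0 _
  calc _ ≤ 1.35 * B ^ ((d : ℝ) / 4) := mul_le_mul h1 h2 (by positivity) (by norm_num)
    _ ≤ (1 - 0.0425) * (1.5 * B ^ ((d : ℝ) / 4)) := by linarith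
    _ ≤ _ := by gcongr

theorem mainTheorem3 {d n L : ℕ} (hd : 1 ≤ d)
    (Ω : Finset (Fin d → ℝ)) (hΩ : Ω.Nonempty) (Λ : Fin L → Finset (Fin d → ℝ))
    (N lam : ℕ) (C : ℝ) (hN : N = n + 1)
    (hΛ : IsClusteredConfiguration N Ω Λ)
    (hlam : lam = maxClusterCard Λ) (hC : C = clusterComplexity Ω N) :
    -- (i)
    (∀ β : ℕ, β = (if Odd d then d + 1 else d + 2) →
      2 * β ^ 2 * lam < N →
      ENNReal.ofReal (6 * d * lam * ((lam : ℝ) ^ lam * C) ^ (1 / ((d : ℝ) + 1)))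
        ≤ clusterSep N Λ →
      (3 * (d : ℝ) ^ ((d : ℝ) / 4) * (lam : ℝ) ^ ((lam : ℝ) + (d : ℝ) / 2 - 1 / 2))⁻¹
          * ((N : ℝ) ^ ((d : ℝ) / 2) / C)
        ≤ sigmaMin (vandermondeMatrix Ω n)) ∧
    -- (ii)
    (∀ β : ℕ, β = 2 * ⌈(1 / 2 : ℝ) * Real.log
          (2 ^ d * (2 ^ d - 1) * (lam : ℝ) ^ lam * (riemannZeta 2).re * C)⌉₊ →
      2 * β ^ 2 * lam < N →
      ENNReal.ofReal (3.3 * lam * (2.5 + 1.4 * d + lam * Real.log lam + Real.log C))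
        ≤ clusterSep N Λ →
      (1.5 * (2.5 + 1.4 * (d : ℝ) + lam * Real.log lam + Real.log C) ^ ((d : ℝ) / 4)
            * (lam : ℝ) ^ ((lam : ℝ) + (d : ℝ) / 2 - 1 / 2))⁻¹
          * ((N : ℝ) ^ ((d : ℝ) / 2) / C)
        ≤ sigmaMin (vandermondeMatrix Ω n)) := by
  exact ⟨le_sigmaMin_of_polynomial_separation hd Ω hΩ Λ N lam C hN hΛ hlam hC,
    le_sigmaMin_of_logarithmic_separation hd Ω hΩ Λ N lam C hN hΛ hlam hC⟩
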